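/- Let $D$ be an integral domain with quotient field $K$. For a nonzero fractional ideal $A$ of $D$ put $A^{-1}=\{x\in K: xA\subseteq D\}$, $A_v=(A^{-1})^{-1}$, and $A_t=\bigcup\{J_v : J\subseteq A \text{ a nonzero finitely generated fractional ideal}\}$. A fractional $t$-ideal is a nonzero fractional ideal $A$ with $A_t=A$, and a $t$-ideal is a fractional $t$-ideal contained in $D$. Let $T_t(D)$ be the abelian group of fractional $t$-ideals $A$ with $(AA^{-1})_t=D$ under $(A,B)\mapsto (AB)_t$, and let $\mathrm{Cl}_t(D)$ be its quotient by the subgroup of nonzero principal fractional ideals. An ideal $I$ of $D$ is a valuation ideal if $IV\cap D=I$ for some valuation ring $V$ with $D\subseteq V\subseteq K$ and quotient field $K$; a valuation element is a nonzero nonunit $a\in D$ such that $aD$ is a valuation ideal. The domain $D$ is called * a $t$-VIFD if for every nonzero $a\in D$ there are $n\ge 1$ and valuation ideals $I_1,\dots,I_n$ of $D$ with $aD=(I_1\cdots I_n)_t$; * atomic if every nonzero nonunit of $D$ is a finite product of irreducible elements; * an AVFD if for every nonzero nonunit $a\in D$ there is $n\ge 1$ such that $a^n$ is a finite product of valuation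 elements; * a Krull domain if $D$ is completely integrally closed (each $x\in K$ such that $cx^n\in D$ for all $n\ge 1$, for some nonzero $c\in D$, lies in $D$) and satisfies the ascending chain condition on $t$-ideals. **Theorem 5.10.** Suppose that $\mathrm{Cl}_t(D)$ has finite exponent, i.e., there is an integer $k\ge 1$ such that $g^k=1$ for all $g\in\mathrm{Cl}_t(D)$. Then $D$ is a Krull domain if and only if $D$ is an atomic $t$-VIFD, and in this case $D$ is an AVFD. -/

import Mathlib

open scoped nonZeroDivisors

noncomputable section

namespace TOp

open FractionalIdeal

section Closure

variable {D : Type*} [CommRing D] [IsDomain D] {K : Type*} [Field K] [Algebra D K]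
  [IsFractionRing D K]

/-- The divisorial closure `A_v = (A⁻¹)⁻¹` of a fractional ideal, where `A⁻¹ = (D : A)`
(with `0_v = 0`). -/
def vClosure (A : FractionalIdeal D⁰ K) : FractionalIdeal D⁰ K := (A⁻¹)⁻¹

theorem vClosure_zero : vClosure (0 : FractionalIdeal D⁰ K) = 0 := by
  simp [vClosure, inv_zero']

theorem inv_ne_zero_of_ne_zero {A : FractionalIdeal D⁰ K} (hA : A ≠ 0) : A⁻¹ ≠ 0 := by
  obtain ⟨a, J, ha, h⟩ := exists_eq_spanSingleton_mul A
  have haK : algebraMap D K a ≠ 0 := by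
    simpa using ha
  intro h0
  have : algebraMap D K a ∈ A⁻¹ := by
    rw [mem_inv_iff hA]
    intro y hy
    rw [h, mem_singleton_mul] at hy
    obtain ⟨z, hz, rfl⟩ := hy
    rw [← mul_assoc, mul_inv_cancel₀ haK, one_mul]
    exact coeIdeal_le_one hz
  rw [h0, mem_zero_iff] at this
  exact haK this

set_option linter.unusedSectionVars false in
theorem fractionalIdeal_mul_ne_zero {A B : FractionalIdeal D⁰ K} (hA : A ≠ 0) (hB : B ≠ 0) :
    A * B ≠ 0 := by
  intro h
  refine hA ((eq_zero_iff).2 fun a ha => by_contra fun ha0 => hB ((eq_zero_iff).2 fun b hb => ?_))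
  have hab : a * b ∈ A * B := mul_mem_mul ha hb
  rw [h, mem_zero_iff] at hab
  exact (mul_eq_zero.1 hab).resolve_left ha0

theorem le_vClosure (A : FractionalIdeal D⁰ K) : A ≤ vClosure A := by
  rcases eq_or_ne A 0 with rfl | hA
  · exact (zero_le _)
  · intro x hx
    rw [vClosure, mem_inv_iff (inv_ne_zero_of_ne_zero hA)]
    intro y hy
    rw [mul_comm]
    exact (mem_inv_iff hA).1 hy x hx

theorem vClosure_mono {A B : FractionalIdeal D⁰ K} (h : A ≤ B) : vClosure A ≤ vClosure B := by
  rcases eq_or_ne A 0 with rfl | hA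
  · rw [vClosure_zero]; exact (zero_le _)
  · have hB : B ≠ 0 := by
      rintro rfl
      exact hA (le_antisymm h (zero_le _))
    exact inv_anti_mono (inv_ne_zero_of_ne_zero hB) (inv_ne_zero_of_ne_zero hA)
      (inv_anti_mono hA hB h)

theorem vClosure_inv (A : FractionalIdeal D⁰ K) : vClosure A⁻¹ = A⁻¹ := by
  rcases eq_or_ne A 0 with rfl | hA
  · rw [inv_zero', vClosure_zero]
  · refine le_antisymm ?_ (le_vClosure _)
    exact inv_anti_mono hA (fun h => hA (le_antisymm (h ▸ le_vClosure A) (zero_le _)))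
      (le_vClosure A)

theorem vClosure_idem (A : FractionalIdeal D⁰ K) : vClosure (vClosure A) = vClosure A :=
  vClosure_inv _

/-- The `t`-closure `A_t = ⋃ {J_v | J ⊆ A finitely generated}` of a fractional ideal. The ideal
`J = 0` contributes only `0`, so allowing it does not change the union when `A ≠ 0`, and it
gives `0_t = 0`. -/
def tClosure (A : FractionalIdeal D⁰ K) : FractionalIdeal D⁰ K :=
  ⟨{ carrier := {x | ∃ J : FractionalIdeal D⁰ K,
        J ≤ A ∧ (J : Submodule D K).FG ∧ x ∈ vClosure J}
     zero_mem' := ⟨0, zero_le _, by simpa using Submodule.fg_bot, by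
        rw [vClosure_zero, mem_zero_iff]⟩
     add_mem' := by
        rintro x y ⟨J, hJ, hJf, hx⟩ ⟨L, hL, hLf, hy⟩
        refine ⟨J ⊔ L, sup_le hJ hL, by rw [coe_sup]; exact hJf.sup hLf, ?_⟩
        exact Submodule.add_mem (vClosure (J ⊔ L) : Submodule D K)
          (vClosure_mono (le_sup_left (a := J) (b := L)) hx)
          (vClosure_mono (le_sup_right (a := J) (b := L)) hy)
     smul_mem' := by
        rintro c x ⟨J, hJ, hJf, hx⟩
        exact ⟨J, hJ, hJf, Submodule.smul_mem (vClosure J : Submodule D K) c hx⟩ },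
   by
    obtain ⟨a, ha, h⟩ := (vClosure A).2
    refine ⟨a, ha, ?_⟩
    rintro x ⟨J, hJ, -, hx⟩
    exact h x (vClosure_mono hJ hx)⟩

theorem mem_tClosure {A : FractionalIdeal D⁰ K} {x : K} :
    x ∈ tClosure A ↔ ∃ J : FractionalIdeal D⁰ K,
      J ≤ A ∧ (J : Submodule D K).FG ∧ x ∈ vClosure J := Iff.rfl

set_option linter.unusedSectionVars false in
theorem fg_spanSingleton (x : K) : (spanSingleton D⁰ x : Submodule D K).FG := by
  rw [coe_spanSingleton]; exact Submodule.fg_span_singleton x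

theorem le_tClosure (A : FractionalIdeal D⁰ K) : A ≤ tClosure A := fun x hx =>
  ⟨spanSingleton D⁰ x, spanSingleton_le_iff_mem.2 hx, fg_spanSingleton x,
    le_vClosure _ (mem_spanSingleton_self _ x)⟩

theorem tClosure_le_vClosure (A : FractionalIdeal D⁰ K) : tClosure A ≤ vClosure A := by
  rintro x ⟨J, hJ, -, hx⟩
  exact vClosure_mono hJ hx

theorem tClosure_mono {A B : FractionalIdeal D⁰ K} (h : A ≤ B) : tClosure A ≤ tClosure B := by
  rintro x ⟨J, hJ, hJf, hx⟩
  exact ⟨J, hJ.trans h, hJf, hx⟩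

theorem exists_fg_of_le_tClosure {A : FractionalIdeal D⁰ K} (N : Submodule D K) (hN : N.FG) :
    N ≤ (tClosure A : Submodule D K) → ∃ J : FractionalIdeal D⁰ K,
      J ≤ A ∧ (J : Submodule D K).FG ∧ N ≤ (vClosure J : Submodule D K) := by
  induction N, hN using Submodule.fg_induction with
  | singleton x =>
    intro h
    obtain ⟨J, hJ, hJf, hx⟩ := h (Submodule.mem_span_singleton_self x)
    exact ⟨J, hJ, hJf, (Submodule.span_singleton_le_iff_mem _ _).2 hx⟩
  | sup N₁ N₂ hN₁ hN₂ h₁ h₂ =>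
    intro h
    obtain ⟨J, hJ, hJf, hx⟩ := h₁ (le_sup_left.trans h)
    obtain ⟨L, hL, hLf, hy⟩ := h₂ (le_sup_right.trans h)
    refine ⟨J ⊔ L, sup_le hJ hL, by rw [coe_sup]; exact hJf.sup hLf, sup_le ?_ ?_⟩
    · exact hx.trans (vClosure_mono (le_sup_left (a := J) (b := L)))
    · exact hy.trans (vClosure_mono (le_sup_right (a := J) (b := L)))

theorem tClosure_idem (A : FractionalIdeal D⁰ K) : tClosure (tClosure A) = tClosure A := by
  refine le_antisymm ?_ (le_tClosure _)
  rintro x ⟨J, hJ, hJf, hx⟩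
  obtain ⟨L, hL, hLf, h⟩ := exists_fg_of_le_tClosure (J : Submodule D K) hJf hJ
  exact ⟨L, hL, hLf, vClosure_idem L ▸ vClosure_mono (show J ≤ vClosure L from h) hx⟩

theorem tClosure_inv (A : FractionalIdeal D⁰ K) : tClosure A⁻¹ = A⁻¹ :=
  le_antisymm ((tClosure_le_vClosure _).trans (vClosure_inv A).le) (le_tClosure _)

theorem tClosure_spanSingleton (x : K) :
    tClosure (spanSingleton D⁰ x) = spanSingleton D⁰ x := by
  have h := tClosure_inv (spanSingleton D⁰ x⁻¹)
  rwa [spanSingleton_inv, inv_inv] at h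

theorem tClosure_one : tClosure (1 : FractionalIdeal D⁰ K) = 1 := by
  simpa using tClosure_spanSingleton (D := D) (1 : K)

theorem tClosure_mul_le (A B : FractionalIdeal D⁰ K) : tClosure A * B ≤ tClosure (A * B) := by
  rw [mul_le]
  rintro x ⟨J, hJ, hJf, hx⟩ b hb
  refine ⟨J * spanSingleton D⁰ b, mul_le_mul' hJ (spanSingleton_le_iff_mem.2 hb), ?_, ?_⟩
  · rw [coe_mul]; exact hJf.mul (fg_spanSingleton b)
  · rcases eq_or_ne J 0 with rfl | hJ0
    · rw [vClosure_zero] at hx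
      have hx' : x = 0 := (mem_zero_iff _).1 hx
      rw [hx', zero_mul]
      exact zero_le (vClosure _) ((mem_zero_iff _).2 (by simp))
    rcases eq_or_ne b 0 with rfl | hb0
    · rw [mul_zero]
      exact zero_le (vClosure _) ((mem_zero_iff _).2 (by simp))
    have hJb : J * spanSingleton D⁰ b ≠ 0 := fractionalIdeal_mul_ne_zero hJ0 (spanSingleton_ne_zero_iff.2 hb0)
    rw [vClosure, mem_inv_iff (inv_ne_zero_of_ne_zero hJb)]
    intro y hy
    rw [mem_inv_iff hJb] at hy
    have hx' := (mem_inv_iff (inv_ne_zero_of_ne_zero hJ0)).1 hx (b * y) (by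
      rw [mem_inv_iff hJ0]
      intro z hz
      have := hy (z * b) (mul_mem_mul hz (mem_spanSingleton_self _ b))
      convert this using 1
      ring)
    convert hx' using 1
    ring

theorem tClosure_tClosure_mul (A B : FractionalIdeal D⁰ K) :
    tClosure (tClosure A * B) = tClosure (A * B) :=
  le_antisymm ((tClosure_mono (tClosure_mul_le A B)).trans (tClosure_idem _).le)
    (tClosure_mono (mul_le_mul' (le_tClosure A) le_rfl))

theorem tClosure_mul_tClosure (A B : FractionalIdeal D⁰ K) :
    tClosure (A * tClosure B) = tClosure (A * B) := by
  rw [mul_comm, tClosure_tClosure_mul, mul_comm]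

theorem tClosure_ne_zero {A : FractionalIdeal D⁰ K} (hA : A ≠ 0) : tClosure A ≠ 0 := fun h =>
  hA (le_antisymm (h ▸ le_tClosure A) (zero_le _))

theorem le_inv_tClosure {A : FractionalIdeal D⁰ K} (hA : A ≠ 0) : A⁻¹ ≤ (tClosure A)⁻¹ := by
  have h := inv_anti_mono (tClosure_ne_zero hA)
    (inv_ne_zero_of_ne_zero (inv_ne_zero_of_ne_zero hA)) (tClosure_le_vClosure A)
  exact (vClosure_inv A).ge.trans h

end Closure

/-- `A` is a `t`-invertible fractional `t`-ideal: `A ≠ 0`, `A_t = A` and `(A A⁻¹)_t = D`. -/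
structure IsTInvertibleTIdeal {D : Type*} [CommRing D] [IsDomain D] {K : Type*} [Field K]
    [Algebra D K] [IsFractionRing D K] (A : FractionalIdeal D⁰ K) : Prop where
  ne_zero : A ≠ 0
  tClosure_eq : tClosure A = A
  tInvertible : tClosure (A * A⁻¹) = 1

/-- The set `T_t(D)` of `t`-invertible fractional `t`-ideals. -/
def TInv (D : Type*) [CommRing D] [IsDomain D] (K : Type*) [Field K] [Algebra D K]
    [IsFractionRing D K] : Type _ :=
  {A : FractionalIdeal D⁰ K // IsTInvertibleTIdeal A}

section Group

variable {D : Type*} [CommRing D] [IsDomain D] {K : Type*} [Field K] [Algebra D K]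
  [IsFractionRing D K]

theorem IsTInvertibleTIdeal.of_one_le {A : FractionalIdeal D⁰ K} (h0 : A ≠ 0)
    (ht : tClosure A = A) (h : 1 ≤ tClosure (A * A⁻¹)) : IsTInvertibleTIdeal A :=
  ⟨h0, ht, le_antisymm
    ((tClosure_mono (mul_one_div_le_one (I := A))).trans tClosure_one.le) h⟩

theorem isTInvertibleTIdeal_spanSingleton {x : K} (hx : x ≠ 0) :
    IsTInvertibleTIdeal (spanSingleton D⁰ x) :=
  ⟨spanSingleton_ne_zero_iff.2 hx, tClosure_spanSingleton x, by
    rw [spanSingleton_mul_inv K hx, tClosure_one]⟩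

theorem IsTInvertibleTIdeal.mul {A B : FractionalIdeal D⁰ K} (hA : IsTInvertibleTIdeal A)
    (hB : IsTInvertibleTIdeal B) : IsTInvertibleTIdeal (tClosure (A * B)) := by
  have h0 := fractionalIdeal_mul_ne_zero hA.ne_zero hB.ne_zero
  refine .of_one_le (tClosure_ne_zero h0) (tClosure_idem _) ?_
  have h1 : A⁻¹ * B⁻¹ ≤ (A * B)⁻¹ := by
    rw [inv_eq (I := A * B), le_div_iff_mul_le h0, mul_mul_mul_comm]
    calc A⁻¹ * A * (B⁻¹ * B) ≤ 1 * 1 := by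
          refine mul_le_mul' ?_ ?_ <;> rw [mul_comm] <;> exact mul_one_div_le_one
      _ = 1 := one_mul 1
  calc (1 : FractionalIdeal D⁰ K) = tClosure (A * A⁻¹ * (B * B⁻¹)) := by
        rw [← tClosure_tClosure_mul, hA.tInvertible, one_mul, hB.tInvertible]
    _ ≤ _ := tClosure_mono (by
        rw [mul_mul_mul_comm]
        exact mul_le_mul' (le_tClosure _) (h1.trans (le_inv_tClosure h0)))

theorem IsTInvertibleTIdeal.inv {A : FractionalIdeal D⁰ K} (hA : IsTInvertibleTIdeal A) :
    IsTInvertibleTIdeal A⁻¹ := by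
  refine .of_one_le (inv_ne_zero_of_ne_zero hA.ne_zero) (tClosure_inv A) ?_
  rw [← hA.tInvertible, mul_comm A]
  exact tClosure_mono (mul_le_mul' le_rfl (le_vClosure A))

/-- `T_t(D)` is an abelian group under `(A, B) ↦ (AB)_t`, with identity `D` and inverse
`A ↦ A⁻¹`. -/
instance : CommGroup (TInv D K) where
  mul A B := ⟨tClosure (A.1 * B.1), A.2.mul B.2⟩
  one := ⟨1, by simpa using isTInvertibleTIdeal_spanSingleton (D := D) (one_ne_zero (α := K))⟩
  inv A := ⟨A.1⁻¹, A.2.inv⟩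
  mul_assoc A B C := Subtype.ext <| by
    change tClosure (tClosure (A.1 * B.1) * C.1) = tClosure (A.1 * tClosure (B.1 * C.1))
    rw [tClosure_tClosure_mul, tClosure_mul_tClosure, mul_assoc]
  one_mul A := Subtype.ext <| by
    change tClosure (1 * A.1) = A.1
    rw [one_mul, A.2.tClosure_eq]
  mul_one A := Subtype.ext <| by
    change tClosure (A.1 * 1) = A.1
    rw [mul_one, A.2.tClosure_eq]
  inv_mul_cancel A := Subtype.ext <| by
    change tClosure (A.1⁻¹ * A.1) = 1
    rw [mul_comm, A.2.tInvertible]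
  mul_comm A B := Subtype.ext <| by
    change tClosure (A.1 * B.1) = tClosure (B.1 * A.1)
    rw [mul_comm]

end Group

variable (D : Type*) [CommRing D] [IsDomain D] (K : Type*) [Field K] [Algebra D K]
  [IsFractionRing D K]

/-- The subgroup `Prin(D)` of `T_t(D)` of nonzero principal fractional ideals `xD`. -/
def prin : Subgroup (TInv D K) where
  carrier := {A | ∃ x : K, x ≠ 0 ∧ A.1 = spanSingleton D⁰ x}
  mul_mem' := by
    rintro A B ⟨x, hx, hA⟩ ⟨y, hy, hB⟩
    refine ⟨x * y, mul_ne_zero hx hy, ?_⟩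
    change tClosure (A.1 * B.1) = _
    rw [hA, hB, spanSingleton_mul_spanSingleton, tClosure_spanSingleton]
  one_mem' := ⟨1, one_ne_zero, (spanSingleton_one (S := D⁰)).symm⟩
  inv_mem' := by
    rintro A ⟨x, hx, hA⟩
    refine ⟨x⁻¹, inv_ne_zero hx, ?_⟩
    change A.1⁻¹ = _
    rw [hA, spanSingleton_inv]

/-- The `t`-class group `Cl_t(D) = T_t(D) / Prin(D)`. -/
abbrev TClassGroup : Type _ := TInv D K ⧸ prin D K

variable {D} in
/-- An ideal `I` of `D` is a valuation ideal if `IV ∩ D = I` for some valuation overring `V`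
of `D`, i.e. some valuation ring `V` with `D ⊆ V ⊆ K` and quotient field `K`. -/
def IsValuationIdeal (I : Ideal D) : Prop :=
  ∃ (V : ValuationSubring K) (hV : ∀ d : D, algebraMap D K d ∈ V),
    (I.map ((algebraMap D K).codRestrict V hV)).comap ((algebraMap D K).codRestrict V hV) = I

variable {D} in
/-- A valuation element is a nonzero nonunit `a` such that `aD` is a valuation ideal. -/
def IsValuationElement (a : D) : Prop :=
  a ≠ 0 ∧ ¬ IsUnit a ∧ IsValuationIdeal K (Ideal.span {a})

/-- `D` is a `t`-VIFD: each nonzero principal ideal is `(I₁ ⋯ Iₙ)_t` for some `n ≥ 1` and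
valuation ideals `I₁, …, Iₙ` of `D`. -/
def IsTVIFD : Prop :=
  ∀ a : D, a ≠ 0 → ∃ s : Multiset (Ideal D), s ≠ 0 ∧ (∀ I ∈ s, IsValuationIdeal K I) ∧
    ((Ideal.span {a} : Ideal D) : FractionalIdeal D⁰ K)
      = tClosure ((s.prod : Ideal D) : FractionalIdeal D⁰ K)

/-- `D` is an almost valuation factorization domain: each nonzero nonunit has a positive power
that is a finite product of valuation elements. -/
def IsAVFD : Prop :=
  ∀ a : D, a ≠ 0 → ¬ IsUnit a → ∃ n : ℕ, 0 < n ∧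
    ∃ s : Multiset D, (∀ v ∈ s, IsValuationElement K v) ∧ a ^ n = s.prod

/-- `D` is atomic: each nonzero nonunit is a finite product of atoms. -/
def IsAtomicDomain (D : Type*) [CommRing D] : Prop :=
  ∀ a : D, a ≠ 0 → ¬ IsUnit a → ∃ s : Multiset D, (∀ u ∈ s, Irreducible u) ∧ a = s.prod

/-- `D` is a Mori domain: ascending chains of (nonzero, integral) `t`-ideals stabilize. -/
def IsMoriDomain : Prop :=
  ∀ f : ℕ →o Ideal D,
    (∀ n, f n ≠ ⊥ ∧ tClosure (f n : FractionalIdeal D⁰ K) = (f n : FractionalIdeal D⁰ K)) →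
    ∃ m, ∀ k, m ≤ k → f k = f m

/-- `D` is completely integrally closed: if `x ∈ K` and there is a nonzero `c ∈ D` with
`c xⁿ ∈ D` for all `n`, then `x ∈ D`. -/
def IsCompletelyIntegrallyClosed : Prop :=
  ∀ x : K, IsAlmostIntegral D x → x ∈ (algebraMap D K).range

/-- A Krull domain is a completely integrally closed Mori domain. -/
structure IsKrullDomain : Prop where
  isCompletelyIntegrallyClosed : IsCompletelyIntegrallyClosed D K
  isMoriDomain : IsMoriDomain D K

end TOp

end

/-! Order the group `T_t(D)` of t-invertible t-ideals by reverse inclusion, and let `H` be its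
subgroup of principal ideals. Finite exponent of the class group says that every `g ^ k` lies in
`H`, for one fixed `k > 0`. Most of the implication from atomic t-VIFD to Krull then becomes a
statement about ordered abelian groups.

A valuation overring `V` gives a total preorder on `T_t(D)`, and the t-closure of a valuation ideal,
when t-invertible, is an element `g` for which divisibility by `g` can be read off that preorder
("valued"). Atoms of `H` valued by the same preorder coincide, so if `g` is valued, all atoms
dividing `g ^ k` are equal and `g ^ k = p ^ m` (or `1`). Over each such atom `p`, the valued `P`
with the least positive exponent in `P ^ k = p ^ m` is prime, and every other valued element over
`p` is a power of `P` (`IsAtomOf.exists_isPrimeOf`). Hence every principal integral ideal is a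
t-product of t-invertible primes.

Such primes are maximal t-ideals, so an integral t-ideal containing a product of them can be divided
by one prime at a time until it becomes `D`. Thus every integral t-ideal is t-invertible
(`AllTInvertible`), which yields complete integral closure and, through t-finiteness, the chain
condition.

Conversely, in a Krull domain all integral t-ideals are t-invertible, and noetherian induction
factors them into primes. Prime ideals are valuation ideals, so `D` is a t-VIFD; atomicity is
noetherian induction on principal ideals. With finite exponent, the `k`-th power of each prime
factor is generated by an element that is still valued, hence is a valuation element after an
enlargement of `V`; this gives the AVFD property. -/

namespace TOp

/-! ### Ordered abelian groups: valued elements, atoms and primes -/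

section OrderedGroup

set_option linter.unusedSectionVars false

variable {G : Type*} [CommGroup G] [PartialOrder G] [IsOrderedMonoid G]

/-- A submonoid of an ordered group is a valuation cone if it contains the positive cone and
induces a total preorder; it plays the role of the elements of nonnegative value. -/
structure IsValuationCone (N : Submonoid G) : Prop where
  mem_of_one_le : ∀ h, 1 ≤ h → h ∈ N
  total : ∀ h, h ∈ N ∨ h⁻¹ ∈ N

/-- A positive element `g` is valued by `N` if among positive elements, being above `g` is
detected by the preorder of `N`. -/
structure IsValuedBy (N : Submonoid G) (g : G) : Prop where
  one_le : 1 ≤ g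
  le_of_div_mem : ∀ h, 1 ≤ h → h / g ∈ N → g ≤ h

/-- `g` is valued by some valuation cone. -/
def IsValued (g : G) : Prop := ∃ N : Submonoid G, IsValuationCone N ∧ IsValuedBy N g

/-- A minimal strictly positive element of the subgroup `H`. -/
structure IsAtomOf (H : Subgroup G) (p : G) : Prop where
  mem : p ∈ H
  one_lt : 1 < p
  eq_of_le : ∀ q ∈ H, 1 < q → q ≤ p → q = p

/-- A positive element that is prime with respect to the positive elements of `H`. -/
structure IsPrimeOf (H : Subgroup G) (P : G) : Prop where
  one_le : 1 ≤ P
  le_or_le : ∀ x ∈ H, ∀ y ∈ H, 1 ≤ x → 1 ≤ y → P ≤ x * y → P ≤ x ∨ P ≤ y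

variable {N : Submonoid G} {H : Subgroup G} {g f p q : G}

theorem eq_one_of_pow_eq_one {k : ℕ} (hk : 0 < k) (hg : 1 ≤ g) (h : g ^ k = 1) : g = 1 := by
  refine le_antisymm ?_ hg
  rw [← h]
  exact le_self_pow hg hk.ne'

/-- Multiplying the test element `h` by the cofactor `g / f` turns a question about `f` into one
about `g`. -/
theorem IsValuedBy.of_le (hg : IsValuedBy N g) (hf : 1 ≤ f) (hfg : f ≤ g) : IsValuedBy N f := by
  refine ⟨hf, fun h hh hhf => ?_⟩
  have hgf : 1 ≤ g / f := one_le_div'.2 hfg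
  have := hg.le_of_div_mem (h * (g / f)) (one_le_mul hh hgf) (by
    convert hhf using 1
    rw [div_eq_mul_inv, div_eq_mul_inv, div_eq_mul_inv]
    rw [mul_assoc, mul_right_comm, mul_inv_cancel, one_mul])
  rw [mul_div_left_comm] at this
  have h2 := one_le_div'.2 this
  rw [mul_div_cancel_left] at h2
  exact one_le_div'.1 h2

theorem IsValuedBy.pow (hN : IsValuationCone N) (hg : IsValuedBy N g) (n : ℕ) :
    IsValuedBy N (g ^ n) := by
  refine ⟨one_le_pow_of_one_le' hg.one_le n, ?_⟩
  induction n with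
  | zero => intro h hh _; simpa using hh
  | succ n ih =>
    intro h hh hm
    have h1 : h / g = h / g ^ (n + 1) * g ^ n := by
      rw [pow_succ', ← div_div, div_mul_cancel]
    have h2 : g ≤ h := hg.le_of_div_mem h hh (h1 ▸ N.mul_mem hm
      (hN.mem_of_one_le _ (one_le_pow_of_one_le' hg.one_le n)))
    have h3 := ih (h / g) (one_le_div'.2 h2) (by rwa [div_div, ← pow_succ'])
    rwa [le_div_iff_mul_le, ← pow_succ] at h3

/-- The preorder of `N` compares `p` with `q`; valuedness upgrades this to comparability in `G`, and
minimality forces equality. -/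
theorem IsAtomOf.eq_of_isValuedBy (hN : IsValuationCone N) (hp : IsAtomOf H p)
    (hq : IsAtomOf H q) (hpN : IsValuedBy N p) (hqN : IsValuedBy N q) : p = q := by
  rcases hN.total (p / q) with h | h
  · exact (hp.eq_of_le q hq.mem hq.one_lt (hqN.le_of_div_mem p hpN.one_le h)).symm
  · rw [inv_div] at h
    exact hq.eq_of_le p hp.mem hp.one_lt (hpN.le_of_div_mem q hqN.one_le h)

theorem one_le_multiset_prod (s : Multiset G) (hs : ∀ x ∈ s, 1 ≤ x) : 1 ≤ s.prod := by
  induction s using Multiset.induction with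
  | empty => simp
  | cons a s ih =>
    rw [Multiset.prod_cons]
    exact one_le_mul (hs a (Multiset.mem_cons_self a s))
      (ih fun x hx => hs x (Multiset.mem_cons_of_mem hx))

theorem le_multiset_prod (s : Multiset G) (hs : ∀ x ∈ s, 1 ≤ x) {a : G} (ha : a ∈ s) :
    a ≤ s.prod := by
  obtain ⟨t, rfl⟩ := Multiset.exists_cons_of_mem ha
  rw [Multiset.prod_cons]
  exact le_mul_of_one_le_right' (one_le_multiset_prod t fun x hx =>
    hs x (Multiset.mem_cons_of_mem hx))

/-- The positive elements of `H` are products of atoms of `H`. -/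
def IsAtomicIn (H : Subgroup G) : Prop :=
  ∀ h ∈ H, 1 ≤ h → ∃ s : Multiset G, (∀ p ∈ s, IsAtomOf H p) ∧ h = s.prod

/-- The power `g ^ k` is valued by the same cone as `g`, and so is each atom in its factorization,
being below it. All these atoms are therefore equal. -/
theorem IsValued.exists_pow_eq {k : ℕ} (hH : IsAtomicIn H)
    (hkH : ∀ g : G, g ^ k ∈ H) (hg : IsValued g) :
    g ^ k = 1 ∨ ∃ p m, IsAtomOf H p ∧ IsValued p ∧ 0 < m ∧ g ^ k = p ^ m := by
  obtain ⟨N, hN, hgN⟩ := hg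
  have hgk := hgN.pow hN k
  obtain ⟨s, hs, hgs⟩ := hH _ (hkH g) hgk.one_le
  rcases s.empty_or_exists_mem with rfl | ⟨p, hp⟩
  · left; simpa using hgs
  · right
    have hval : ∀ q ∈ s, IsValuedBy N q := fun q hq => hgk.of_le (hs q hq).one_lt.le
      (hgs ▸ le_multiset_prod s (fun x hx => (hs x hx).one_lt.le) hq)
    have hrep := Multiset.eq_replicate_card.2 fun q hq =>
      (hs q hq).eq_of_isValuedBy hN (hs p hp) (hval q hq) (hval p hp)
    refine ⟨p, Multiset.card s, hs p hp, ⟨N, hN, hval p hp⟩, Multiset.card_pos_iff_exists_mem.2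
      ⟨p, hp⟩, ?_⟩
    rw [hgs, hrep, Multiset.prod_replicate, Multiset.card_replicate]

/-- All powers of `g` have value less than `p`. -/
def IsInfinitelyBelow (N : Submonoid G) (p g : G) : Prop := ∀ n : ℕ, g ^ n / p ∉ N

theorem IsInfinitelyBelow.mul (hN : IsValuationCone N) (hf : IsInfinitelyBelow N p f)
    (hg : IsInfinitelyBelow N p g) : IsInfinitelyBelow N p (f * g) := by
  intro n hn
  -- Whichever factor has the larger value, `(f * g) ^ n` has at most the value of its `2n`-th
  -- power.
  rcases hN.total (f / g) with h | h
  · refine hf (n + n) ?_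
    convert N.mul_mem hn (N.pow_mem h n) using 1
    rw [div_mul_eq_mul_div, mul_pow, div_pow, mul_assoc, mul_div_cancel, pow_add]
  · refine hg (n + n) ?_
    rw [inv_div] at h
    convert N.mul_mem hn (N.pow_mem h n) using 1
    rw [div_mul_eq_mul_div, mul_pow, div_pow, mul_right_comm, mul_div_cancel, pow_add]

theorem IsInfinitelyBelow.pow (hf : IsInfinitelyBelow N p f) (m : ℕ) :
    IsInfinitelyBelow N p (f ^ m) := by
  intro n hn
  rw [← pow_mul] at hn
  exact hf _ hn

theorem isInfinitelyBelow_one (hp : IsAtomOf H p) (hpN : IsValuedBy N p) :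
    IsInfinitelyBelow N p 1 := by
  intro n hn
  rw [one_pow] at hn
  exact hp.one_lt.not_ge (hpN.le_of_div_mem 1 le_rfl hn)

/-- Descent on the exponent: a relation `p ≤ q ^ (n + 1)` lets one factor `q` be cancelled from the
cofactor `q ^ (n + 1) / p`, until `p ≤ q` contradicts minimality. Only `q` has to be valued. -/
theorem IsAtomOf.not_le_pow (hp : IsAtomOf H p) (hq : IsAtomOf H q) (hqv : IsValued q)
    (hpq : q ≠ p) (n : ℕ) : ¬ p ≤ q ^ n := by
  obtain ⟨N, hN, hqN⟩ := hqv
  induction n with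
  | zero => rw [pow_zero]; exact hp.one_lt.not_ge
  | succ n ih =>
    intro h
    rcases Nat.eq_zero_or_pos n with rfl | hn
    · rw [zero_add, pow_one] at h
      exact hpq (hq.eq_of_le p hp.mem hp.one_lt h).symm
    · obtain ⟨l, rfl⟩ := Nat.exists_eq_add_of_lt hn
      rw [zero_add] at h ih
      -- Otherwise `p / q ∈ N`, and valuedness of `q` gives `q ≤ p`.
      have hc : q / p ∈ N := by
        refine (hN.total _).resolve_right fun h' => ?_
        rw [inv_div] at h'
        exact hpq (hp.eq_of_le q hq.mem hq.one_lt (hqN.le_of_div_mem p hp.one_lt.le h'))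
      have := hqN.le_of_div_mem _ (one_le_div'.2 h) (by
        convert N.mul_mem (N.pow_mem (hN.mem_of_one_le q hqN.one_le) l) hc using 1
        rw [pow_succ, pow_succ, mul_div_assoc', div_right_comm, mul_div_cancel_right])
      apply ih
      rw [pow_succ _ (l + 1), mul_div_right_comm] at this
      exact one_le_div'.1 ((le_mul_iff_one_le_left' _).1 this)

theorem IsAtomOf.isInfinitelyBelow (hp : IsAtomOf H p) (hpN : IsValuedBy N p)
    (hq : IsAtomOf H q) (hqv : IsValued q) (hpq : q ≠ p) : IsInfinitelyBelow N p q := fun n hn =>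
  hp.not_le_pow hq hqv hpq n
    (hpN.le_of_div_mem _ (one_le_pow_of_one_le' hq.one_lt.le n) hn)

/-- If no factor lies over `p`, each `I ^ k` is `1` or a power of another valued atom, hence
infinitely below `p` for a cone valuing `p`. So is their product, which then cannot be above `p`. -/
theorem IsAtomOf.exists_pow_eq_of_le_prod {k : ℕ} (hH : IsAtomicIn H) (hkH : ∀ g : G, g ^ k ∈ H)
    (hp : IsAtomOf H p) (hpv : IsValued p) (s : Multiset G) (hs : ∀ I ∈ s, IsValued I)
    (h : p ≤ s.prod ^ k) : ∃ I ∈ s, ∃ m, 0 < m ∧ I ^ k = p ^ m := by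
  obtain ⟨N, hN, hpN⟩ := hpv
  by_contra! hcon
  have hb : IsInfinitelyBelow N p (s.prod ^ k) := by
    clear h
    induction s using Multiset.induction with
    | empty => simpa using isInfinitelyBelow_one hp hpN
    | cons I s ih =>
      rw [Multiset.prod_cons, mul_pow]
      refine .mul hN ?_ (ih (fun J hJ => hs J (Multiset.mem_cons_of_mem hJ))
        fun J hJ => hcon J (Multiset.mem_cons_of_mem hJ))
      have hI := Multiset.mem_cons_self I s
      rcases (hs I hI).exists_pow_eq hH hkH with h1 | ⟨q, m, hq, hqv, hm, h1⟩
      · rw [h1]; exact isInfinitelyBelow_one hp hpN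
      · rw [h1]
        exact (hp.isInfinitelyBelow hpN hq hqv fun e => hcon I hI m hm (e ▸ h1)).pow m
  refine hb 1 (hN.mem_of_one_le _ ?_)
  rw [pow_one]
  exact one_le_div'.2 h

/-- A valuation cone is closed under roots: if `f / g ∈ N`, then `g / f = (g / f) ^ k * (f / g) ^ (k
- 1)`. So the comparison of exponents passes from `k`-th powers to `f` and `g`. -/
theorem IsValued.le_of_pow_eq {k m₀ m : ℕ} (hk : 0 < k) (hf : IsValued f) (hg : 1 ≤ g)
    (hp : 1 ≤ p) (h₀ : f ^ k = p ^ m₀) (h : g ^ k = p ^ m) (hm : m₀ ≤ m) : f ≤ g := by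
  obtain ⟨N, hN, hfN⟩ := hf
  refine hfN.le_of_div_mem g hg ((hN.total _).elim id fun h' => ?_)
  rw [inv_div] at h'
  have h1 : (g / f) ^ k ∈ N := by
    rw [div_pow, h, h₀]
    exact hN.mem_of_one_le _ (one_le_div'.2 (pow_le_pow_right' hp hm))
  obtain ⟨l, rfl⟩ := Nat.exists_eq_add_of_lt hk
  convert N.mul_mem h1 (N.pow_mem h' l) using 1
  rw [zero_add, pow_succ, ← inv_div g f, inv_pow, mul_inv_cancel_comm]

/-- Over each valued atom `p` there is a prime `P` of which all valued elements with a power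
equal to a power of `p` are themselves powers. -/
theorem IsAtomOf.exists_isPrimeOf {k : ℕ} (hk : 0 < k) (hH : IsAtomicIn H)
    (hkH : ∀ g : G, g ^ k ∈ H)
    (hval : ∀ h ∈ H, 1 ≤ h → ∃ s : Multiset G, (∀ I ∈ s, IsValued I) ∧ h = s.prod)
    (hp : IsAtomOf H p) (hpv : IsValued p) :
    ∃ P, IsPrimeOf H P ∧ ∀ m I, IsValued I → I ^ k = p ^ m → ∃ n : ℕ, I = P ^ n := by
  classical
  -- The atom `p` itself is over `p`, with exponent `k`; the prime `P` will be a valued element of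
  -- least positive exponent.
  have hex : ∃ m, 0 < m ∧ ∃ I : G, IsValued I ∧ I ^ k = p ^ m := ⟨k, hk, p, hpv, rfl⟩
  obtain ⟨hm₀, P, hPv, hP⟩ := Nat.find_spec hex
  set m₀ := Nat.find hex
  have hone : ∀ I : G, IsValued I → 1 ≤ I := fun I ⟨_, _, h⟩ => h.one_le
  have hle : ∀ m I, 0 < m → IsValued I → I ^ k = p ^ m → m₀ ≤ m ∧ P ≤ I := by
    intro m I hm hI h
    have h1 : m₀ ≤ m := Nat.find_min' hex ⟨hm, I, hI, h⟩
    exact ⟨h1, hPv.le_of_pow_eq hk (hone I hI) hp.one_lt.le hP h h1⟩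
  refine ⟨P, ⟨hone P hPv, fun x hx y hy hx1 hy1 hxy => ?_⟩, ?_⟩
  · obtain ⟨s, hs, rfl⟩ := hval x hx hx1
    obtain ⟨t, ht, rfl⟩ := hval y hy hy1
    -- Some valued factor of `x` or `y` lies over `p`; by minimality of `m₀` it is above `P`.
    obtain ⟨I, hI, m, hm, hIm⟩ := hp.exists_pow_eq_of_le_prod hH hkH hpv (s + t)
      (fun I hI => (Multiset.mem_add.1 hI).elim (hs I) (ht I)) (by
        rw [Multiset.prod_add]
        calc p ≤ p ^ m₀ := le_self_pow hp.one_lt.le hm₀.ne'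
          _ = P ^ k := hP.symm
          _ ≤ _ := pow_le_pow_left' hxy k)
    rcases Multiset.mem_add.1 hI with h | h
    · exact .inl ((hle m I hm (hs I h) hIm).2.trans
        (le_multiset_prod s (fun J hJ => hone J (hs J hJ)) h))
    · exact .inr ((hle m I hm (ht I h) hIm).2.trans
        (le_multiset_prod t (fun J hJ => hone J (ht J hJ)) h))
  · intro m
    induction m using Nat.strong_induction_on with
    | _ m ih =>
      intro I hI h
      rcases Nat.eq_zero_or_pos m with rfl | hm
      · exact ⟨0, by simpa using eq_one_of_pow_eq_one hk (hone I hI) (by simpa using h)⟩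
      · obtain ⟨h1, h2⟩ := hle m I hm hI h
        -- `I / P` is positive and below `I`, so it stays valued and its exponent drops by `m₀`.
        have h3 : IsValued (I / P) := by
          obtain ⟨N, hN, hIN⟩ := hI
          exact ⟨N, hN, hIN.of_le (one_le_div'.2 h2) ((div_le_self_iff I).2 (hone P hPv))⟩
        obtain ⟨n, hn⟩ := ih (m - m₀) (by omega) (I / P) h3 (by
          rw [div_pow, h, hP, div_eq_iff_eq_mul, ← pow_add, Nat.sub_add_cancel h1])
        exact ⟨n + 1, by rw [pow_succ, ← hn, div_mul_cancel]⟩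

theorem exists_isPrimeOf_factorization {k : ℕ} (hk : 0 < k) (hH : IsAtomicIn H)
    (hkH : ∀ g : G, g ^ k ∈ H)
    (hval : ∀ h ∈ H, 1 ≤ h → ∃ s : Multiset G, (∀ I ∈ s, IsValued I) ∧ h = s.prod)
    {h : G} (hh : h ∈ H) (h1 : 1 ≤ h) :
    ∃ s : Multiset G, (∀ P ∈ s, IsPrimeOf H P) ∧ h = s.prod := by
  obtain ⟨s, hs, rfl⟩ := hval h hh h1
  clear hh h1
  induction s using Multiset.induction with
  | empty => exact ⟨0, by simp, rfl⟩
  | cons I s ih =>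
    obtain ⟨t, ht, hst⟩ := ih fun J hJ => hs J (Multiset.mem_cons_of_mem hJ)
    have hI := hs I (Multiset.mem_cons_self I s)
    obtain ⟨r, hr, hIr⟩ : ∃ r : Multiset G, (∀ P ∈ r, IsPrimeOf H P) ∧ I = r.prod := by
      rcases hI.exists_pow_eq hH hkH with h1 | ⟨p, m, hp, hpv, -, hm⟩
      · obtain ⟨_, _, hI'⟩ := hI
        exact ⟨0, by simp, by simpa using eq_one_of_pow_eq_one hk hI'.one_le h1⟩
      · obtain ⟨P, hP, hPI⟩ := hp.exists_isPrimeOf hk hH hkH hval hpv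
        obtain ⟨n, rfl⟩ := hPI m I hI hm
        exact ⟨Multiset.replicate n P, fun Q hQ => Multiset.eq_of_mem_replicate hQ ▸ hP,
          by simp⟩
    refine ⟨r + t, fun P hP => (Multiset.mem_add.1 hP).elim (hr P) (ht P), ?_⟩
    rw [Multiset.prod_cons, Multiset.prod_add, ← hst, ← hIr]

end OrderedGroup

noncomputable section

open FractionalIdeal

/-! ### t-invertible t-ideals, and domains in which every integral t-ideal is one -/

section TInvertible

variable {D : Type*} [CommRing D] [IsDomain D] {K : Type*} [Field K] [Algebra D K]
  [IsFractionRing D K]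

/-- `T_t(D)` is ordered by reverse inclusion, so that its positive elements are the integral
`t`-invertible `t`-ideals. -/
instance : PartialOrder (TInv D K) where
  le A B := B.1 ≤ A.1
  le_refl A := le_refl A.1
  le_trans _ _ _ h₁ h₂ := le_trans h₂ h₁
  le_antisymm _ _ h₁ h₂ := Subtype.ext (le_antisymm h₂ h₁)

theorem TInv.le_iff {A B : TInv D K} : A ≤ B ↔ B.1 ≤ A.1 := Iff.rfl

theorem TInv.coe_mul (A B : TInv D K) : (A * B).1 = tClosure (A.1 * B.1) := rfl

theorem TInv.coe_one : (1 : TInv D K).1 = 1 := rfl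

theorem TInv.one_le_iff {A : TInv D K} : 1 ≤ A ↔ A.1 ≤ 1 := Iff.rfl

theorem TInv.coe_div (A B : TInv D K) : (A / B).1 = tClosure (A.1 * B.1⁻¹) := by
  rw [div_eq_mul_inv]; rfl

instance : IsOrderedMonoid (TInv D K) where
  mul_le_mul_left _ _ h _ := tClosure_mono (mul_le_mul' h le_rfl)

omit [IsDomain D] in
theorem spanSingleton_le_one_iff {x : K} :
    spanSingleton D⁰ x ≤ 1 ↔ ∃ d : D, algebraMap D K d = x := by
  rw [spanSingleton_le_iff_mem, mem_one_iff]

omit [IsDomain D] [IsFractionRing D K] in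
theorem exists_fg_le_mul {M P : Submodule D K} (N : Submodule D K) (hN : N.FG) :
    N ≤ M * P → ∃ J ≤ M, J.FG ∧ N ≤ J * P := by
  induction N, hN using Submodule.fg_induction with
  | singleton x =>
    intro h
    obtain ⟨T, T', hT, hT', hx⟩ := Submodule.mem_span_mul_finite_of_mem_mul
      (h (Submodule.mem_span_singleton_self x))
    refine ⟨Submodule.span D T, Submodule.span_le.2 hT, ⟨T, rfl⟩, ?_⟩
    rw [Submodule.span_singleton_le_iff_mem]
    rw [← Submodule.span_mul_span] at hx
    exact mul_le_mul' le_rfl (Submodule.span_le.2 hT') hx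
  | sup N₁ N₂ hN₁ hN₂ h₁ h₂ =>
    intro h
    obtain ⟨J, hJ, hJf, hx⟩ := h₁ (le_sup_left.trans h)
    obtain ⟨L, hL, hLf, hy⟩ := h₂ (le_sup_right.trans h)
    exact ⟨J ⊔ L, sup_le hJ hL, hJf.sup hLf,
      sup_le (hx.trans (mul_le_mul' le_sup_left le_rfl))
        (hy.trans (mul_le_mul' le_sup_right le_rfl))⟩

theorem tClosure_zero : tClosure (0 : FractionalIdeal D⁰ K) = 0 :=
  le_antisymm ((tClosure_le_vClosure _).trans vClosure_zero.le) (zero_le _)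

theorem tClosure_eq_vClosure_of_fg {J : FractionalIdeal D⁰ K} (hJ : (J : Submodule D K).FG) :
    tClosure J = vClosure J :=
  le_antisymm (tClosure_le_vClosure J) fun _ hx => ⟨J, le_rfl, hJ, hx⟩

theorem tClosure_mul_eq_one {A B : FractionalIdeal D⁰ K} (hA : tClosure A = 1)
    (hB : tClosure B = 1) : tClosure (A * B) = 1 := by
  rw [← tClosure_tClosure_mul, hA, one_mul, hB]

theorem tClosure_le_of_le {A B : FractionalIdeal D⁰ K} (h : A ≤ tClosure B) :
    tClosure A ≤ tClosure B := (tClosure_mono h).trans (tClosure_idem B).le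

theorem le_tClosure_mul_of_tClosure_eq_one (A : FractionalIdeal D⁰ K) {L : FractionalIdeal D⁰ K}
    (hL : tClosure L = 1) : A ≤ tClosure (A * L) := by
  rw [← tClosure_mul_tClosure, hL, mul_one]
  exact le_tClosure A

/-- A t-inverse of `A` is `B` times the inverse of the product. -/
theorem IsTInvertibleTIdeal.of_mul {A B : FractionalIdeal D⁰ K}
    (h : IsTInvertibleTIdeal (tClosure (A * B))) : IsTInvertibleTIdeal (tClosure A) := by
  have h0 : A ≠ 0 := by
    rintro rfl
    exact h.ne_zero (by rw [zero_mul, tClosure_zero])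
  set C := (tClosure (A * B))⁻¹
  have h1 : tClosure (A * (B * C)) = 1 := by
    rw [← mul_assoc, ← tClosure_tClosure_mul, h.tInvertible]
  have h2 : B * C ≤ A⁻¹ := by
    rw [inv_eq (I := A), le_div_iff_mul_le h0, mul_comm]
    exact (le_tClosure _).trans h1.le
  refine .of_one_le (tClosure_ne_zero h0) (tClosure_idem _) ?_
  rw [← h1]
  exact tClosure_mono (mul_le_mul' (le_tClosure A) (h2.trans (le_inv_tClosure h0)))

/-- t-invertible implies t-finite: `1` already lies in the v-closure of a finitely generated `J' ⊆ I
A⁻¹`, and writing the generators of `J'` uses only a finitely generated `J ⊆ I`. Then `I J' ⊆ J`,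
and t-closing removes `J'`. -/
theorem IsTInvertibleTIdeal.exists_fg {I : FractionalIdeal D⁰ K}
    (h : IsTInvertibleTIdeal (tClosure I)) :
    ∃ J ≤ I, (J : Submodule D K).FG ∧ tClosure J = tClosure I := by
  set A := tClosure I
  have h1 : (1 : K) ∈ tClosure (I * A⁻¹) := by
    rw [← tClosure_tClosure_mul, h.tInvertible]
    exact one_mem_one _
  obtain ⟨J', hJ', hJ'f, h1⟩ := h1
  obtain ⟨J, hJ, hJf, hJJ⟩ := exists_fg_le_mul (J' : Submodule D K) hJ'f
    (by rw [← coe_mul]; exact hJ')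
  refine ⟨⟨J, isFractional_of_le hJ⟩, hJ, hJf, le_antisymm (tClosure_mono hJ) ?_⟩
  set J0 : FractionalIdeal D⁰ K := ⟨J, isFractional_of_le hJ⟩
  have hJJ0 : J' ≤ J0 * A⁻¹ := by
    rw [← coe_le_coe, coe_mul]; exact hJJ
  have h2 : I * J' ≤ J0 := calc
    I * J' ≤ A * (J0 * A⁻¹) := mul_le_mul' (le_tClosure I) hJJ0
    _ = J0 * (A * A⁻¹) := mul_left_comm _ _ _
    _ ≤ J0 * 1 := mul_le_mul' le_rfl mul_one_div_le_one
    _ = J0 := mul_one _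
  refine tClosure_le_of_le (le_trans ?_ (tClosure_mono h2))
  have h3 : (1 : FractionalIdeal D⁰ K) ≤ tClosure J' := by
    rw [tClosure_eq_vClosure_of_fg hJ'f]
    exact one_le.2 h1
  calc I = I * 1 := (mul_one I).symm
    _ ≤ I * tClosure J' := mul_le_mul' le_rfl h3
    _ ≤ tClosure (I * tClosure J') := le_tClosure _
    _ = _ := tClosure_mul_tClosure _ _

theorem IsTInvertibleTIdeal.spanSingleton_le_one {P : FractionalIdeal D⁰ K}
    (hP : IsTInvertibleTIdeal P) {u : K} (h : spanSingleton D⁰ u * P ≤ P) :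
    spanSingleton D⁰ u ≤ 1 := calc
  spanSingleton D⁰ u ≤ tClosure (spanSingleton D⁰ u * (P * P⁻¹)) :=
    le_tClosure_mul_of_tClosure_eq_one _ hP.tInvertible
  _ ≤ tClosure (P * P⁻¹) := tClosure_mono (by rw [← mul_assoc]; exact mul_le_mul' h le_rfl)
  _ = 1 := hP.tInvertible

/-- The class of a nonzero element of `K` in `T_t(D)`. -/
def principal (x : K) (hx : x ≠ 0) : TInv D K :=
  ⟨spanSingleton D⁰ x, isTInvertibleTIdeal_spanSingleton hx⟩

theorem principal_mem_prin {x : K} (hx : x ≠ 0) : principal x hx ∈ prin D K := ⟨x, hx, rfl⟩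

theorem exists_eq_spanSingleton_of_mem_prin {h : TInv D K} (hh : h ∈ prin D K) (h1 : 1 ≤ h) :
    ∃ d : D, d ≠ 0 ∧ h.1 = spanSingleton D⁰ (algebraMap D K d) := by
  obtain ⟨x, hx, hA⟩ := hh
  obtain ⟨d, rfl⟩ := spanSingleton_le_one_iff.1 (hA ▸ TInv.one_le_iff.1 h1)
  exact ⟨d, fun h0 => hx (by rw [h0, map_zero]), hA⟩

/-- A `t`-invertible prime `t`-ideal is a maximal `t`-ideal. -/
theorem IsPrimeOf.tClosure_sup_eq_one {P : TInv D K} (hP : IsPrimeOf (prin D K) P) {y : D}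
    (hy : algebraMap D K y ∉ P.1) :
    tClosure (P.1 ⊔ spanSingleton D⁰ (algebraMap D K y)) = 1 := by
  set y' := algebraMap D K y with hy'
  have hy0 : y' ≠ 0 := fun h => hy (h ▸ P.1.zero_mem)
  have hP1 : P.1 ≤ 1 := hP.one_le
  refine le_antisymm ((tClosure_mono (sup_le hP1 (spanSingleton_le_one_iff.2 ⟨y, rfl⟩))).trans
    tClosure_one.le) (FractionalIdeal.one_le.2 ?_)
  have hP2 := P.2.tClosure_eq
  obtain ⟨J, hJP, hJf, hJ⟩ := IsTInvertibleTIdeal.exists_fg (hP2.symm ▸ P.2)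
  rw [hP2] at hJ
  have hJ0 : J ≠ 0 := by
    rintro rfl
    exact P.2.ne_zero (by rw [← hJ, tClosure_zero])
  refine ⟨J ⊔ spanSingleton D⁰ y', sup_le_sup_right hJP _, ?_, ?_⟩
  · rw [coe_sup]; exact hJf.sup (fg_spanSingleton y')
  have hs0 : J ⊔ spanSingleton D⁰ y' ≠ 0 := fun h =>
    hJ0 (le_antisymm (h ▸ le_sup_left (a := J)) (zero_le _))
  rw [vClosure, mem_inv_iff (inv_ne_zero_of_ne_zero hs0)]
  intro u hu
  rw [one_mul, ← spanSingleton_le_iff_mem]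
  have huJ : u ∈ P.1⁻¹ := by
    rw [← hJ]
    refine le_inv_tClosure hJ0 ?_
    exact inv_anti_mono hJ0 hs0 le_sup_left hu
  have huy : u * y' ∈ (1 : FractionalIdeal D⁰ K) := (mem_inv_iff hs0).1 hu y'
    (le_sup_right (a := J) (mem_spanSingleton_self _ y'))
  -- To show `u ∈ D` it suffices that `u P ⊆ P`. For `z ∈ P`, both `u z` and `u y` are in `D` and
  -- `(u z) y = (u y) z ∈ P`; as `y ∉ P`, primality on principal ideals puts `u z` in `P`.
  refine P.2.spanSingleton_le_one ?_
  intro w hw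
  obtain ⟨z, hz, rfl⟩ := mem_singleton_mul.1 hw
  rcases eq_or_ne (u * z) 0 with h0 | h0
  · rw [h0]; exact P.1.zero_mem
  have huz : u * z ∈ (1 : FractionalIdeal D⁰ K) := (mem_inv_iff P.2.ne_zero).1 huJ z hz
  have := hP.le_or_le _ (principal_mem_prin h0) _ (principal_mem_prin hy0)
    (spanSingleton_le_iff_mem.2 huz) (spanSingleton_le_one_iff.2 ⟨y, rfl⟩) (by
      rw [TInv.le_iff, TInv.coe_mul, ← hP2]
      refine tClosure_mono ?_
      change spanSingleton _ _ * spanSingleton _ _ ≤ _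
      rw [spanSingleton_mul_spanSingleton, spanSingleton_le_iff_mem]
      obtain ⟨d, hd⟩ := (mem_one_iff _).1 huy
      have : u * z * y' = d • z := by rw [Algebra.smul_def, hd]; ring
      rw [this]
      exact P.1.1.smul_mem d hz)
  rcases this with h | h
  · exact spanSingleton_le_iff_mem.1 h
  · exact absurd (spanSingleton_le_iff_mem.1 h) hy

omit [IsDomain D] [IsFractionRing D K] in
theorem sup_mul_sup_le {A P Q : FractionalIdeal D⁰ K} (hA : A ≤ 1) (hP : P ≤ 1) (hQ : Q ≤ 1) :
    (A ⊔ P) * (A ⊔ Q) ≤ A ⊔ P * Q := by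
  simp only [sup_eq_add, mul_add, add_mul]
  simp only [← sup_eq_add]
  refine sup_le (sup_le ?_ ?_) (sup_le ?_ le_sup_right)
  · exact (mul_le_of_le_one_right' hA).trans le_sup_left
  · exact (mul_le_of_le_one_left' hP).trans le_sup_left
  · exact (mul_le_of_le_one_right' hQ).trans le_sup_left

theorem tClosure_sup_prod_eq_one {A : FractionalIdeal D⁰ K} (hA : A ≤ 1)
    (s : Multiset (TInv D K)) (hs : ∀ P ∈ s, P.1 ≤ 1 ∧ tClosure (A ⊔ P.1) = 1) :
    tClosure (A ⊔ s.prod.1) = 1 := by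
  induction s using Multiset.induction with
  | empty => rw [Multiset.prod_zero, TInv.coe_one, sup_eq_right.2 hA, tClosure_one]
  | cons P s ih =>
    obtain ⟨hP1, hP⟩ := hs P (Multiset.mem_cons_self P s)
    have hs' := ih fun Q hQ => hs Q (Multiset.mem_cons_of_mem hQ)
    have hs1 : s.prod.1 ≤ 1 := one_le_multiset_prod s fun Q hQ =>
      (hs Q (Multiset.mem_cons_of_mem hQ)).1
    rw [Multiset.prod_cons, TInv.coe_mul]
    refine le_antisymm ((tClosure_mono (sup_le hA ((tClosure_mono
      (mul_le_one' hP1 hs1)).trans tClosure_one.le))).trans tClosure_one.le) ?_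
    rw [← tClosure_mul_eq_one hP hs']
    exact tClosure_mono ((sup_mul_sup_le hA hP1 hs1).trans (sup_le_sup_left (le_tClosure _) A))

/-- Induction on the number of primes. If `A` lies in one of them, divide both `A` and the product
by it. If not, `A` is t-comaximal to each prime by t-maximality, hence to the product; but `A`
contains the product, so `A = D`. -/
theorem isTInvertibleTIdeal_of_prod_le (s : Multiset (TInv D K))
    (hs : ∀ P ∈ s, IsPrimeOf (prin D K) P) :
    ∀ {A : FractionalIdeal D⁰ K}, A ≤ 1 → tClosure A = A → s.prod.1 ≤ A →
      IsTInvertibleTIdeal A := by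
  induction hn : Multiset.card s generalizing s with
  | zero =>
    intro A hA _ hsA
    rw [Multiset.card_eq_zero] at hn
    subst hn
    rw [Multiset.prod_zero, TInv.coe_one] at hsA
    rw [le_antisymm hA hsA]
    exact (1 : TInv D K).2
  | succ n ih =>
    intro A hA hAt hsA
    by_cases h : ∃ P ∈ s, A ≤ P.1
    · obtain ⟨P, hP, hAP⟩ := h
      obtain ⟨t, rfl⟩ := Multiset.exists_cons_of_mem hP
      rw [Multiset.prod_cons, TInv.coe_mul] at hsA
      have hA' := ih t (fun Q hQ => hs Q (Multiset.mem_cons_of_mem hQ)) (by simpa using hn)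
        (A := tClosure (A * P.1⁻¹))
        ((tClosure_mono (mul_le_mul' hAP le_rfl)).trans P.2.tInvertible.le) (tClosure_idem _) (by
          refine (le_tClosure_mul_of_tClosure_eq_one _ P.2.tInvertible).trans (tClosure_mono ?_)
          rw [← mul_assoc, mul_comm t.prod.1]
          exact mul_le_mul' ((le_tClosure _).trans hsA) le_rfl)
      have := hA'.mul P.2
      rwa [tClosure_tClosure_mul, mul_assoc, mul_comm P.1⁻¹, ← tClosure_mul_tClosure,
        P.2.tInvertible, mul_one, hAt] at this
    · push Not at h
      have h1 := tClosure_sup_prod_eq_one hA s fun P hP => by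
        refine ⟨(hs P hP).one_le, ?_⟩
        obtain ⟨x, hxA, hxP⟩ := SetLike.not_le_iff_exists.1 (h P hP)
        obtain ⟨y, rfl⟩ := (mem_one_iff _).1 (hA hxA)
        refine le_antisymm ((tClosure_mono (sup_le hA (hs P hP).one_le)).trans tClosure_one.le) ?_
        rw [← (hs P hP).tClosure_sup_eq_one hxP]
        exact tClosure_mono (sup_le le_sup_right
          ((spanSingleton_le_iff_mem.2 hxA).trans le_sup_left))
      rw [sup_eq_left.2 hsA, hAt] at h1
      rw [h1]
      exact (1 : TInv D K).2

variable (D K) in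
/-- All integral `t`-ideals of `D` are `t`-invertible. -/
def AllTInvertible : Prop :=
  ∀ A : FractionalIdeal D⁰ K, A ≠ 0 → A ≤ 1 → tClosure A = A → IsTInvertibleTIdeal A

theorem allTInvertible_of_factorization
    (h : ∀ h ∈ prin D K, 1 ≤ h → ∃ s : Multiset (TInv D K),
      (∀ P ∈ s, IsPrimeOf (prin D K) P) ∧ h = s.prod) : AllTInvertible D K := by
  intro A hA0 hA hAt
  obtain ⟨x, hx, hx0⟩ : ∃ x ∈ A, x ≠ 0 := by
    by_contra! hcon
    exact hA0 (eq_zero_iff.2 hcon)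
  have hxA := spanSingleton_le_iff_mem.2 hx
  obtain ⟨s, hs, hxs⟩ := h _ (principal_mem_prin hx0) (hxA.trans hA)
  exact isTInvertibleTIdeal_of_prod_le s hs hA hAt (hxs ▸ hxA)

/-- If all `r x ^ n` lie in `D`, they generate an integral ideal stable under `x`; its t-closure is
t-invertible, and cancelling it leaves `x ∈ D`. -/
theorem AllTInvertible.isCompletelyIntegrallyClosed (h : AllTInvertible D K) :
    IsCompletelyIntegrallyClosed D K := by
  rintro x ⟨r, hr, hx⟩
  set M : Submodule D K := Submodule.span D (Set.range fun n : ℕ => r • x ^ n)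
  have hM1 : M ≤ 1 := by
    refine Submodule.span_le.2 ?_
    rintro _ ⟨n, rfl⟩
    obtain ⟨d, hd⟩ := hx n
    exact Submodule.mem_one.2 ⟨d, hd⟩
  set A : FractionalIdeal D⁰ K := ⟨M, isFractional_of_le_one M hM1⟩
  have hA1 : A ≤ 1 := by
    rw [← coe_le_coe, coe_one]; exact hM1
  have hA0 : A ≠ 0 := by
    intro h0
    have : algebraMap D K r ∈ A :=
      Submodule.subset_span ⟨0, by simp [Algebra.smul_def]⟩
    rw [h0, mem_zero_iff] at this
    exact nonZeroDivisors.ne_zero hr (by simpa using this)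
  have hxA : spanSingleton D⁰ x * A ≤ A := by
    have hle : M ≤ M.comap (LinearMap.mulLeft D x) := by
      refine Submodule.span_le.2 ?_
      rintro _ ⟨n, rfl⟩
      exact Submodule.subset_span ⟨n + 1, by
        simp only [LinearMap.mulLeft_apply, mul_smul_comm, pow_succ']⟩
    exact spanSingleton_mul_le_iff.2 fun z hz => hle hz
  have hA := h _ (tClosure_ne_zero hA0) ((tClosure_mono hA1).trans tClosure_one.le)
    (tClosure_idem A)
  obtain ⟨d, hd⟩ := spanSingleton_le_one_iff.1 (hA.spanSingleton_le_one (u := x) (by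
    rw [mul_comm]
    refine (tClosure_mul_le _ _).trans (tClosure_mono ?_)
    rwa [mul_comm]))
  exact ⟨d, hd⟩

/-- The union of the chain has the t-closure of some finitely generated subideal, which already lies
in one term of the chain. -/
theorem AllTInvertible.isMoriDomain (h : AllTInvertible D K) : IsMoriDomain D K := by
  intro f hf
  set I : Ideal D := ⨆ n, f n
  have hI0 : (I : FractionalIdeal D⁰ K) ≠ 0 := by
    rw [coeIdeal_ne_zero]
    exact fun h0 => (hf 0).1 (le_bot_iff.1 (h0 ▸ le_iSup (fun n => f n) 0))
  obtain ⟨J, hJI, hJf, hJ⟩ := (h _ (tClosure_ne_zero hI0)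
    ((tClosure_mono coeIdeal_le_one).trans tClosure_one.le) (tClosure_idem _)).exists_fg
  obtain ⟨J, rfl⟩ := le_one_iff_exists_coeIdeal.1 (hJI.trans coeIdeal_le_one)
  rw [coeIdeal_le_coeIdeal] at hJI
  rw [coeIdeal_fg D⁰ (IsFractionRing.injective D K)] at hJf
  obtain ⟨m, hm⟩ : ∃ m, J ≤ f m := by
    obtain ⟨_, ⟨m, rfl⟩, hm⟩ :=
      (CompleteLattice.isCompactElement_iff_le_of_directed_sSup_le _ J).1
        ((Submodule.fg_iff_compact J).1 hJf) (Set.range f) (Set.range_nonempty f)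
        (directedOn_range.2 f.monotone.directed_le) hJI
    exact ⟨m, hm⟩
  refine ⟨m, fun k hk => le_antisymm ?_ (f.monotone hk)⟩
  rw [← coeIdeal_le_coeIdeal K, ← (hf m).2]
  calc (f k : FractionalIdeal D⁰ K) ≤ I := (coeIdeal_le_coeIdeal K).2 (le_iSup (fun n => f n) k)
    _ ≤ tClosure I := le_tClosure _
    _ = tClosure J := hJ.symm
    _ ≤ _ := tClosure_mono ((coeIdeal_le_coeIdeal K).2 hm)

end TInvertible

/-! ### From valuation overrings to valuation cones on `T_t(D)` -/

section Valuation

set_option linter.unusedSectionVars false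

variable {D : Type*} [CommRing D] [IsDomain D] {K : Type*} [Field K] [Algebra D K]
  [IsFractionRing D K] (V : ValuationSubring K) (hV : ∀ d : D, algebraMap D K d ∈ V)

/-- An overring of `D` as a `D`-submodule of the quotient field. -/
def overringSubmodule : Submodule D K where
  carrier := V
  zero_mem' := V.zero_mem
  add_mem' := V.add_mem _ _
  smul_mem' c x hx := by
    rw [Algebra.smul_def]
    exact V.mul_mem _ _ (hV c) hx

variable {V hV} in
theorem mem_overringSubmodule {x : K} : x ∈ overringSubmodule V hV ↔ x ∈ V := Iff.rfl

theorem overringSubmodule_mul_le {A B : Submodule D K} (hA : A ≤ overringSubmodule V hV)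
    (hB : B ≤ overringSubmodule V hV) : A * B ≤ overringSubmodule V hV :=
  Submodule.mul_le.2 fun _ ha _ hb => V.mul_mem _ _ (hA ha) (hB hb)

theorem coe_le_overringSubmodule {A : FractionalIdeal D⁰ K} (hA : A ≤ 1) :
    (A : Submodule D K) ≤ overringSubmodule V hV := fun x hx => by
  obtain ⟨d, rfl⟩ := (mem_one_iff _).1 (hA hx)
  exact hV d

/-- The `t`-invertible `t`-ideals that are contained in a valuation overring `V` up to an
integral ideal with `t`-closure `D`. -/
def valuationCone : Submonoid (TInv D K) where
  carrier := {A | ∃ L : FractionalIdeal D⁰ K, L ≤ 1 ∧ tClosure L = 1 ∧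
    ((A.1 * L : FractionalIdeal D⁰ K) : Submodule D K) ≤ overringSubmodule V hV}
  one_mem' := ⟨1, le_rfl, tClosure_one, by
    rw [TInv.coe_one, mul_one]; exact coe_le_overringSubmodule V hV le_rfl⟩
  mul_mem' := by
    rintro A B ⟨L, hL, hLt, hAL⟩ ⟨M, hM, hMt, hBM⟩
    -- The t-closure of a product of ideals inside `V` may leave `V`. The factors `A A⁻¹` and `B
    -- B⁻¹` repair this: `(AB)_t A⁻¹ B⁻¹ ⊆ D`, which leaves `(A L)(B M) ⊆ V`.
    refine ⟨A.1 * A.1⁻¹ * (B.1 * B.1⁻¹) * (L * M), mul_le_one' (mul_le_one' mul_one_div_le_one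
      mul_one_div_le_one) (mul_le_one' hL hM), tClosure_mul_eq_one (tClosure_mul_eq_one
      A.2.tInvertible B.2.tInvertible) (tClosure_mul_eq_one hLt hMt), ?_⟩
    rw [TInv.coe_mul]
    have h : tClosure (A.1 * B.1) * (A.1⁻¹ * B.1⁻¹) ≤ 1 := by
      refine (tClosure_mul_le _ _).trans ?_
      rw [mul_mul_mul_comm, tClosure_mul_eq_one A.2.tInvertible B.2.tInvertible]
    rw [show tClosure (A.1 * B.1) * (A.1 * A.1⁻¹ * (B.1 * B.1⁻¹) * (L * M)) =
      tClosure (A.1 * B.1) * (A.1⁻¹ * B.1⁻¹) * ((A.1 * L) * (B.1 * M)) by ring, coe_mul,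
      coe_mul (A.1 * L)]
    exact overringSubmodule_mul_le V hV (coe_le_overringSubmodule V hV h)
      (overringSubmodule_mul_le V hV hAL hBM)

theorem isValuationCone_valuationCone : IsValuationCone (valuationCone V hV) where
  mem_of_one_le A hA := ⟨1, le_rfl, tClosure_one, by
    rw [mul_one]; exact coe_le_overringSubmodule V hV hA⟩
  total A := by
    by_cases h : ((A⁻¹).1 : Submodule D K) ≤ overringSubmodule V hV
    · right; exact ⟨1, le_rfl, tClosure_one, by rwa [mul_one]⟩
    · left
      -- For such a `u`, `u A ⊆ D` and `u⁻¹ ∈ V`, so `A ⊆ u⁻¹ D ⊆ V`.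
      obtain ⟨u, hu, huV⟩ := SetLike.not_le_iff_exists.1 h
      refine ⟨1, le_rfl, tClosure_one, ?_⟩
      rw [mul_one]
      intro x hx
      have hu0 : u ≠ 0 := fun h0 => huV (h0 ▸ V.zero_mem)
      obtain ⟨d, hd⟩ := (mem_one_iff _).1 ((mem_inv_iff A.2.ne_zero).1 hu x hx)
      have : x = u⁻¹ * algebraMap D K d := by rw [hd, inv_mul_cancel_left₀ hu0]
      rw [mem_overringSubmodule, this]
      exact V.mul_mem _ _ ((V.mem_or_inv_mem u).resolve_left huV) (hV d)

theorem exists_mem_map_of_mem_mul {I : Ideal D} {x : K}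
    (hx : x ∈ overringSubmodule V hV * ((I : FractionalIdeal D⁰ K) : Submodule D K)) :
    ∃ w ∈ I.map ((algebraMap D K).codRestrict V hV), (w : K) = x := by
  induction hx using Submodule.mul_induction_on' with
  | mem_mul_mem v hv i hi =>
    obtain ⟨j, hj, rfl⟩ := (mem_coeIdeal _).1 hi
    exact ⟨⟨v, hv⟩ * (algebraMap D K).codRestrict V hV j,
      Ideal.mul_mem_left _ _ (Ideal.mem_map_of_mem _ hj), rfl⟩
  | add x _ y _ hx hy =>
    obtain ⟨w, hw, rfl⟩ := hx
    obtain ⟨z, hz, rfl⟩ := hy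
    exact ⟨w + z, Ideal.add_mem _ hw hz, rfl⟩

/-- If `B A⁻¹ L ⊆ V`, then `B (A⁻¹ I L) ⊆ I V ∩ D = I`. Since `A⁻¹ I` and `L` both have t-closure
`D`, t-closing gives `B ⊆ I_t = A`. -/
theorem isValuedBy_valuationCone {I : Ideal D}
    (hI : (I.map ((algebraMap D K).codRestrict V hV)).comap
      ((algebraMap D K).codRestrict V hV) = I)
    {A : TInv D K} (hA : A.1 = tClosure (I : FractionalIdeal D⁰ K)) :
    IsValuedBy (valuationCone V hV) A := by
  have hA1 : A.1 ≤ 1 := hA ▸ (tClosure_mono coeIdeal_le_one).trans tClosure_one.le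
  refine ⟨hA1, ?_⟩
  rintro B hB ⟨L, hL, hLt, hBL⟩
  rw [TInv.coe_div] at hBL
  have hAI : tClosure (A.1⁻¹ * (I : FractionalIdeal D⁰ K)) = 1 := by
    rw [← tClosure_mul_tClosure, ← hA, mul_comm, A.2.tInvertible]
  have hAI1 : A.1⁻¹ * (I : FractionalIdeal D⁰ K) ≤ 1 := (le_tClosure _).trans hAI.le
  have key : B.1 * (A.1⁻¹ * (I : FractionalIdeal D⁰ K) * L) ≤ I := by
    intro x hx
    obtain ⟨d, rfl⟩ := (mem_one_iff _).1 ((mul_le_one' hB (mul_le_one' hAI1 hL)) hx)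
    have hx' : algebraMap D K d ∈ overringSubmodule V hV *
        ((I : FractionalIdeal D⁰ K) : Submodule D K) := by
      have h1 : ((B.1 * (A.1⁻¹ * (I : FractionalIdeal D⁰ K) * L) : FractionalIdeal D⁰ K) :
          Submodule D K) ≤ overringSubmodule V hV *
          ((I : FractionalIdeal D⁰ K) : Submodule D K) := by
        rw [show B.1 * (A.1⁻¹ * (I : FractionalIdeal D⁰ K) * L) = B.1 * A.1⁻¹ * L * I by ring,
          coe_mul]
        refine mul_le_mul' (le_trans ?_ hBL) le_rfl
        exact coe_le_coe.2 (mul_le_mul' (le_tClosure _) le_rfl)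
      exact h1 hx
    obtain ⟨w, hw, hwd⟩ := exists_mem_map_of_mem_mul V hV hx'
    refine (mem_coeIdeal _).2 ⟨d, ?_, rfl⟩
    rw [← hI, Ideal.mem_comap]
    convert hw
    exact Subtype.ext hwd.symm
  rw [TInv.le_iff, hA]
  exact (le_tClosure_mul_of_tClosure_eq_one B.1 (tClosure_mul_eq_one hAI hLt)).trans
    (tClosure_mono key)

theorem IsValuationIdeal.isValued {I : Ideal D} (hI : IsValuationIdeal K I) {A : TInv D K}
    (hA : A.1 = tClosure (I : FractionalIdeal D⁰ K)) : IsValued A := by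
  obtain ⟨V, hV, hI⟩ := hI
  exact ⟨_, isValuationCone_valuationCone V hV, isValuedBy_valuationCone V hV hI hA⟩

theorem coe_le_iff_spanSingleton_mul {u : K} {L : FractionalIdeal D⁰ K} :
    ((spanSingleton D⁰ u * L : FractionalIdeal D⁰ K) : Submodule D K) ≤
      overringSubmodule V hV ↔ ∀ z ∈ L, u * z ∈ V := by
  constructor
  · exact fun h z hz => h (mul_mem_mul (mem_spanSingleton_self _ u) hz)
  · intro h w hw
    obtain ⟨z, hz, rfl⟩ := mem_singleton_mul.1 hw
    exact h z hz

/-- The elements of `K` that are multiplied into `V` by an integral ideal with `t`-closure `D`. -/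
def tLinkedOverring : ValuationSubring K where
  carrier := {u | ∃ L : FractionalIdeal D⁰ K, L ≤ 1 ∧ tClosure L = 1 ∧
    ((spanSingleton D⁰ u * L : FractionalIdeal D⁰ K) : Submodule D K) ≤ overringSubmodule V hV}
  mul_mem' := by
    rintro a b ⟨L, hL, hLt, ha⟩ ⟨M, hM, hMt, hb⟩
    refine ⟨L * M, mul_le_one' hL hM, tClosure_mul_eq_one hLt hMt, ?_⟩
    rw [← spanSingleton_mul_spanSingleton, mul_mul_mul_comm, coe_mul]
    exact overringSubmodule_mul_le V hV ha hb
  one_mem' := ⟨1, le_rfl, tClosure_one, by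
    rw [spanSingleton_one, one_mul]; exact coe_le_overringSubmodule V hV le_rfl⟩
  add_mem' := by
    rintro a b ⟨L, hL, hLt, ha⟩ ⟨M, hM, hMt, hb⟩
    refine ⟨L * M, mul_le_one' hL hM, tClosure_mul_eq_one hLt hMt, ?_⟩
    rw [coe_le_iff_spanSingleton_mul] at *
    intro z hz
    rw [add_mul]
    exact V.add_mem _ _ (ha z (mul_le_of_le_one_right' hM hz))
      (hb z (mul_le_of_le_one_left' hL hz))
  zero_mem' := ⟨1, le_rfl, tClosure_one, by simp⟩
  neg_mem' := by
    rintro a ⟨L, hL, hLt, ha⟩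
    refine ⟨L, hL, hLt, ?_⟩
    rw [coe_le_iff_spanSingleton_mul] at *
    intro z hz
    rw [neg_mul]
    exact V.neg_mem _ (ha z hz)
  mem_or_inv_mem' := by
    intro x
    refine (V.mem_or_inv_mem x).imp ?_ ?_ <;>
    · intro hx
      refine ⟨1, le_rfl, tClosure_one, ?_⟩
      rw [coe_le_iff_spanSingleton_mul]
      intro z hz
      obtain ⟨d, rfl⟩ := (mem_one_iff _).1 hz
      exact V.mul_mem _ _ hx (hV d)

end Valuation

/-! ### Valuation ideals and the implication from atomic t-VIFD to Krull -/

section ValuationIdeal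

variable {D : Type*} [CommRing D] [IsDomain D] {K : Type*} [Field K] [Algebra D K]
  [IsFractionRing D K]

omit [IsDomain D] in
theorem spanSingleton_algebraMap_le_iff {p q : D} :
    spanSingleton D⁰ (algebraMap D K p) ≤ spanSingleton D⁰ (algebraMap D K q) ↔ q ∣ p := by
  rw [spanSingleton_le_iff_mem, mem_spanSingleton]
  constructor
  · rintro ⟨z, hz⟩
    rw [Algebra.smul_def, ← map_mul] at hz
    exact ⟨z, by rw [mul_comm]; exact (IsFractionRing.injective D K hz).symm⟩
  · rintro ⟨z, rfl⟩
    exact ⟨z, by rw [Algebra.smul_def, ← map_mul, mul_comm]⟩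

omit [IsDomain D] in
theorem one_le_spanSingleton_algebraMap_iff {q : D} :
    (1 : FractionalIdeal D⁰ K) ≤ spanSingleton D⁰ (algebraMap D K q) ↔ IsUnit q := by
  rw [← spanSingleton_one, ← map_one (algebraMap D K), spanSingleton_algebraMap_le_iff,
    isUnit_iff_dvd_one]

/-- Converse passage from valued elements to valuation ideals, for principal ideals. The cone of `V`
only sees elements up to an ideal `L` with `L_t = D`, so the witnessing valuation ring is not `V`
but `tLinkedOverring V hV`, whose nonzero elements are those with principal ideal in the cone. -/
theorem isValuationIdeal_span_singleton (V : ValuationSubring K)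
    (hV : ∀ d : D, algebraMap D K d ∈ V) {a : D} (ha : a ≠ 0) {A : TInv D K}
    (hA : A.1 = spanSingleton D⁰ (algebraMap D K a))
    (hval : IsValuedBy (valuationCone V hV) A) : IsValuationIdeal K (Ideal.span {a}) := by
  have ha' : algebraMap D K a ≠ 0 := by simpa using ha
  have hVW : ∀ d : D, algebraMap D K d ∈ tLinkedOverring V hV := fun d =>
    ⟨1, le_rfl, tClosure_one, by
      rw [mul_one]
      exact coe_le_overringSubmodule V hV (spanSingleton_le_one_iff.2 ⟨d, rfl⟩)⟩
  refine ⟨tLinkedOverring V hV, hVW, le_antisymm ?_ Ideal.le_comap_map⟩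
  intro y hy
  rw [Ideal.mem_comap, Ideal.map_span, Set.image_singleton, Ideal.mem_span_singleton'] at hy
  obtain ⟨⟨u, L, hL, hLt, hu⟩, hy⟩ := hy
  have hy' : u * algebraMap D K a = algebraMap D K y := congrArg Subtype.val hy
  rcases eq_or_ne y 0 with rfl | hy0
  · exact Ideal.zero_mem _
  have hy0' : algebraMap D K y ≠ 0 := by simpa using hy0
  have h := hval.le_of_div_mem (principal _ hy0') (spanSingleton_le_one_iff.2 ⟨y, rfl⟩)
    ⟨L, hL, hLt, by
      have h1 : (principal (D := D) _ hy0' / A).1 = spanSingleton D⁰ u := by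
        rw [TInv.coe_div, hA, spanSingleton_inv]
        change tClosure (spanSingleton _ _ * _) = _
        rw [spanSingleton_mul_spanSingleton, tClosure_spanSingleton, ← hy',
          mul_inv_cancel_right₀ ha']
      rwa [h1]⟩
  rw [TInv.le_iff, hA] at h
  exact Ideal.mem_span_singleton.2 (spanSingleton_algebraMap_le_iff.1 h)

-- A valuation ring dominating the localization at `P` has maximal ideal contracting to `P`, so the
-- extension of `P` contracts to `P` as well.
variable (K) in
omit [IsDomain D] in
theorem isValuationIdeal_of_isPrime (P : Ideal D) [hP : P.IsPrime] : IsValuationIdeal K P := by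
  have hunit : ∀ y : P.primeCompl, IsUnit (algebraMap D K y) := fun y => by
    have : (y : D) ≠ 0 := fun h => y.2 (h ▸ P.zero_mem)
    simpa using this
  obtain ⟨V, h, hloc⟩ := IsLocalRing.exists_factor_valuationRing
    (IsLocalization.lift (M := P.primeCompl) (S := Localization.AtPrime P) hunit)
  set f := IsLocalization.lift (M := P.primeCompl) (S := Localization.AtPrime P) hunit
  have hf : ∀ d : D, f (algebraMap D _ d) = algebraMap D K d :=
    fun d => IsLocalization.lift_eq hunit d
  have hV : ∀ d : D, algebraMap D K d ∈ V := fun d => hf d ▸ h _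
  have hiff : ∀ d : D, IsUnit ((algebraMap D K).codRestrict V hV d) ↔ d ∉ P := by
    intro d
    have h1 : (algebraMap D K).codRestrict V hV d =
        f.codRestrict V.toSubring h (algebraMap D _ d) := Subtype.ext (hf d).symm
    rw [h1]
    refine ⟨fun hu => ?_, fun hd => ?_⟩
    · exact (IsLocalization.AtPrime.isUnit_to_map_iff (Localization.AtPrime P) P d).1
        (hloc.map_nonunit _ hu)
    · exact ((IsLocalization.AtPrime.isUnit_to_map_iff (Localization.AtPrime P) P d).2 hd).map
        (f.codRestrict V.toSubring h)
  refine ⟨V, hV, le_antisymm (fun d hd => ?_) Ideal.le_comap_map⟩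
  by_contra hdP
  have hle : P.map ((algebraMap D K).codRestrict V hV) ≤ IsLocalRing.maximalIdeal V :=
    Ideal.map_le_iff_le_comap.2 fun p hp => by
      rw [Ideal.mem_comap, IsLocalRing.mem_maximalIdeal]
      exact fun hu => (hiff p).1 hu hp
  exact (IsLocalRing.mem_maximalIdeal _).1 (hle hd) ((hiff d).2 hdP)

variable (K) in
omit [IsDomain D] [IsFractionRing D K] in
theorem isValuationIdeal_top : IsValuationIdeal K (⊤ : Ideal D) :=
  ⟨⊤, fun _ => ValuationSubring.mem_top _, by rw [Ideal.map_top, Ideal.comap_top]⟩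

/-- Each factor is t-invertible because the product is, so every t-closed factor is an element of
`T_t(D)` and the cone of its valuation ring applies. -/
theorem exists_isValued_factorization (s : Multiset (Ideal D))
    (hs : ∀ I ∈ s, IsValuationIdeal K I)
    (hinv : IsTInvertibleTIdeal (tClosure ((s.prod : Ideal D) : FractionalIdeal D⁰ K))) :
    ∃ t : Multiset (TInv D K), (∀ A ∈ t, IsValued A) ∧
      t.prod.1 = tClosure ((s.prod : Ideal D) : FractionalIdeal D⁰ K) := by
  induction s using Multiset.induction with
  | empty =>
    refine ⟨0, by simp, ?_⟩
    rw [Multiset.prod_zero, Multiset.prod_zero, TInv.coe_one, Ideal.one_eq_top, coeIdeal_top,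
      tClosure_one]
  | cons I s ih =>
    rw [Multiset.prod_cons, coeIdeal_mul] at *
    have hI := hinv.of_mul
    obtain ⟨t, ht, hts⟩ := ih (fun J hJ => hs J (Multiset.mem_cons_of_mem hJ))
      (IsTInvertibleTIdeal.of_mul (by rwa [mul_comm] at hinv))
    obtain ⟨B, hB⟩ : ∃ B : TInv D K, B.1 = tClosure (I : FractionalIdeal D⁰ K) := ⟨⟨_, hI⟩, rfl⟩
    refine ⟨B ::ₘ t, fun A hA => ?_, ?_⟩
    · rcases Multiset.mem_cons.1 hA with rfl | hA
      · exact (hs I (Multiset.mem_cons_self I s)).isValued hB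
      · exact ht A hA
    · rw [Multiset.prod_cons, TInv.coe_mul, hB, hts, tClosure_mul_tClosure, tClosure_tClosure_mul]

theorem IsTVIFD.exists_isValued_factorization (h : IsTVIFD D K) :
    ∀ h ∈ prin D K, 1 ≤ h → ∃ s : Multiset (TInv D K), (∀ I ∈ s, IsValued I) ∧ h = s.prod := by
  intro A hA hA1
  obtain ⟨d, hd, hAd⟩ := exists_eq_spanSingleton_of_mem_prin hA hA1
  obtain ⟨s, -, hs, hds⟩ := h d hd
  rw [coeIdeal_span_singleton, ← hAd] at hds
  obtain ⟨t, ht, hts⟩ := TOp.exists_isValued_factorization s hs (hds ▸ A.2)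
  exact ⟨t, ht, Subtype.ext (hds.trans hts.symm)⟩

variable (K) in
theorem isAtomOf_prin {p : D} (hp : Irreducible p) : ∃ hp0 : algebraMap D K p ≠ 0,
    IsAtomOf (prin D K) (principal (D := D) (algebraMap D K p) hp0) := by
  refine ⟨by simpa using hp.ne_zero, principal_mem_prin _,
    lt_of_le_not_ge (spanSingleton_le_one_iff.2 ⟨p, rfl⟩) fun h => hp.not_isUnit
      (one_le_spanSingleton_algebraMap_iff.1 h), ?_⟩
  intro Q hQ hQ1 hQp
  obtain ⟨q, hq, hQq⟩ := exists_eq_spanSingleton_of_mem_prin hQ hQ1.le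
  refine le_antisymm hQp ?_
  rw [TInv.le_iff, hQq] at hQp ⊢
  obtain ⟨c, hc⟩ := spanSingleton_algebraMap_le_iff.1 hQp
  rcases hp.isUnit_or_isUnit hc with hu | hu
  · refine absurd ?_ hQ1.not_ge
    rw [TInv.le_iff, hQq]
    exact one_le_spanSingleton_algebraMap_iff.2 hu
  · exact spanSingleton_algebraMap_le_iff.2 (hc ▸ hu.mul_right_dvd.2 dvd_rfl)

theorem TInv.coe_mul_eq_spanSingleton {A B : TInv D K} {x y : D}
    (hA : A.1 = spanSingleton D⁰ (algebraMap D K x))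
    (hB : B.1 = spanSingleton D⁰ (algebraMap D K y)) :
    (A * B).1 = spanSingleton D⁰ (algebraMap D K (x * y)) := by
  rw [TInv.coe_mul, hA, hB, spanSingleton_mul_spanSingleton, tClosure_spanSingleton, map_mul]

theorem IsAtomicDomain.isAtomicIn (h : IsAtomicDomain D) : IsAtomicIn (prin D K) := by
  intro A hA hA1
  obtain ⟨d, hd, hAd⟩ := exists_eq_spanSingleton_of_mem_prin hA hA1
  by_cases hu : IsUnit d
  · refine ⟨0, by simp, le_antisymm ?_ hA1⟩
    rw [Multiset.prod_zero, TInv.le_iff, hAd]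
    exact one_le_spanSingleton_algebraMap_iff.2 hu
  · obtain ⟨s, hs, rfl⟩ := h d hd hu
    suffices h : ∃ t : Multiset (TInv D K), (∀ p ∈ t, IsAtomOf (prin D K) p) ∧
        t.prod.1 = spanSingleton D⁰ (algebraMap D K s.prod) by
      obtain ⟨t, ht, hts⟩ := h
      exact ⟨t, ht, Subtype.ext (hAd.trans hts.symm)⟩
    clear hAd hu hd
    induction s using Multiset.induction with
    | empty =>
      refine ⟨0, by simp, ?_⟩
      rw [Multiset.prod_zero, Multiset.prod_zero, map_one, spanSingleton_one, TInv.coe_one]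
    | cons p s ih =>
      obtain ⟨t, ht, hts⟩ := ih fun q hq => hs q (Multiset.mem_cons_of_mem hq)
      obtain ⟨hp0, hp⟩ := isAtomOf_prin K (hs p (Multiset.mem_cons_self p s))
      refine ⟨_ ::ₘ t, fun q hq => (Multiset.mem_cons.1 hq).elim (fun e => e ▸ hp) (ht q), ?_⟩
      rw [Multiset.prod_cons, Multiset.prod_cons]
      exact TInv.coe_mul_eq_spanSingleton rfl hts

theorem exists_pow_mem_prin (hexp : Monoid.ExponentExists (TClassGroup D K)) :
    ∃ k : ℕ, 0 < k ∧ ∀ g : TInv D K, g ^ k ∈ prin D K := by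
  obtain ⟨k, hk, h⟩ := hexp
  exact ⟨k, hk, fun g => (QuotientGroup.eq_one_iff _).1 (by
    rw [QuotientGroup.mk_pow]; exact h g)⟩

theorem isKrullDomain_of_isAtomicDomain_of_isTVIFD
    (hexp : Monoid.ExponentExists (TClassGroup D K)) (hat : IsAtomicDomain D)
    (htv : IsTVIFD D K) : IsKrullDomain D K := by
  obtain ⟨k, hk, hkH⟩ := exists_pow_mem_prin hexp
  have h := allTInvertible_of_factorization fun A hA hA1 =>
    exists_isPrimeOf_factorization hk hat.isAtomicIn hkH htv.exists_isValued_factorization hA hA1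
  exact ⟨h.isCompletelyIntegrallyClosed, h.isMoriDomain⟩

end ValuationIdeal

/-! ### Krull domains: prime factorization, t-VIFD, atomicity and AVFD -/

section Krull

variable {D : Type*} [CommRing D] [IsDomain D] {K : Type*} [Field K] [Algebra D K]
  [IsFractionRing D K]

theorem IsMoriDomain.wellFoundedGT (h : IsMoriDomain D K) :
    WellFoundedGT {I : Ideal D // I ≠ ⊥ ∧
      tClosure (I : FractionalIdeal D⁰ K) = (I : FractionalIdeal D⁰ K)} := by
  rw [wellFoundedGT_iff_monotone_chain_condition]
  intro f
  obtain ⟨m, hm⟩ := h ⟨fun n => (f n).1, fun _ _ hab => f.monotone hab⟩ fun n => (f n).2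
  exact ⟨m, fun k hk => Subtype.ext (hm k hk).symm⟩

/-- In a Mori domain every nonempty set of integral `t`-ideals has a maximal element. -/
theorem IsMoriDomain.exists_maximal (h : IsMoriDomain D K) (S : Set (FractionalIdeal D⁰ K))
    (hS : S.Nonempty) (hS' : ∀ A ∈ S, A ≠ 0 ∧ A ≤ 1 ∧ tClosure A = A) : ∃ M, Maximal (· ∈ S) M := by
  have := h.wellFoundedGT
  obtain ⟨A, hA⟩ := hS
  obtain ⟨hA0, hA1, hAt⟩ := hS' A hA
  obtain ⟨I, rfl⟩ := le_one_iff_exists_coeIdeal.1 hA1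
  obtain ⟨M, hM, hmax⟩ := wellFounded_gt.has_min {J : {I : Ideal D // I ≠ ⊥ ∧
    tClosure (I : FractionalIdeal D⁰ K) = (I : FractionalIdeal D⁰ K)} |
      ((J : Ideal D) : FractionalIdeal D⁰ K) ∈ S} ⟨⟨I, coeIdeal_ne_zero.1 hA0, hAt⟩, hA⟩
  refine ⟨(M : Ideal D), hM, fun B hB hMB => ?_⟩
  obtain ⟨hB0, hB1, hBt⟩ := hS' B hB
  obtain ⟨J, rfl⟩ := le_one_iff_exists_coeIdeal.1 hB1
  have h1 := hmax ⟨J, coeIdeal_ne_zero.1 hB0, hBt⟩ hB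
  have h2 : M.1 ≤ J := (coeIdeal_le_coeIdeal K).1 hMB
  by_contra hJM
  exact h1 (lt_of_le_of_ne h2 fun e => hJM (by rw [e]))

/-- Take a maximal t-closure of a nonzero finitely generated subideal `J` of `B`; adjoining any
element of `B` to `J` cannot enlarge it. -/
theorem IsMoriDomain.exists_fg (h : IsMoriDomain D K) {B : FractionalIdeal D⁰ K} (hB0 : B ≠ 0)
    (hB1 : B ≤ 1) : ∃ J ≤ B, J ≠ 0 ∧ (J : Submodule D K).FG ∧ B ≤ tClosure J := by
  obtain ⟨b, hb, hb0⟩ : ∃ x ∈ B, x ≠ 0 := by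
    by_contra! hcon
    exact hB0 (eq_zero_iff.2 hcon)
  obtain ⟨M, ⟨J, hJB, hJ0, hJf, rfl⟩, hmax⟩ := h.exists_maximal
    {A | ∃ J ≤ B, J ≠ 0 ∧ (J : Submodule D K).FG ∧ tClosure J = A}
    ⟨_, spanSingleton D⁰ b, spanSingleton_le_iff_mem.2 hb, spanSingleton_ne_zero_iff.2 hb0,
      fg_spanSingleton b, rfl⟩ (by
      rintro _ ⟨J, hJB, hJ0, -, rfl⟩
      exact ⟨tClosure_ne_zero hJ0, (tClosure_mono (hJB.trans hB1)).trans tClosure_one.le,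
        tClosure_idem J⟩)
  refine ⟨J, hJB, hJ0, hJf, fun x hx => ?_⟩
  have hle : tClosure J ≤ tClosure (J ⊔ spanSingleton D⁰ x) := tClosure_mono le_sup_left
  refine hmax ⟨J ⊔ spanSingleton D⁰ x, sup_le hJB (spanSingleton_le_iff_mem.2 hx), fun h0 =>
    hJ0 (le_antisymm (h0 ▸ le_sup_left (a := J)) (zero_le _)), ?_, rfl⟩ hle
    (le_tClosure _ (le_sup_right (a := J) (mem_spanSingleton_self _ x)))
  rw [coe_sup]
  exact hJf.sup (fg_spanSingleton x)

theorem IsCompletelyIntegrallyClosed.mem_one (h : IsCompletelyIntegrallyClosed D K)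
    {A : FractionalIdeal D⁰ K} (hA0 : A ≠ 0) {u : K} (hu : ∀ z ∈ A, u * z ∈ A) :
    u ∈ (1 : FractionalIdeal D⁰ K) := by
  obtain ⟨c, hc, hc0⟩ : ∃ x ∈ A, x ≠ 0 := by
    by_contra! hcon
    exact hA0 (eq_zero_iff.2 hcon)
  obtain ⟨r, hr, hrA⟩ := A.2
  obtain ⟨s, hs⟩ := hrA c hc
  have hpow : ∀ n : ℕ, u ^ n * c ∈ A := by
    intro n
    induction n with
    | zero => simpa using hc
    | succ n ih =>
      rw [pow_succ', mul_assoc]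
      exact hu _ ih
  have hr0 : algebraMap D K r ≠ 0 := by simpa using nonZeroDivisors.ne_zero hr
  -- With `r` a denominator of `A` and `0 ≠ c ∈ A`, the element `s = r c` is a common denominator of
  -- all powers of `u`, as `u ^ n * c ∈ A`.
  refine (mem_one_iff _).2 (h u ⟨s, ?_, fun n => ?_⟩)
  · refine mem_nonZeroDivisors_of_ne_zero fun h0 => ?_
    rw [h0, map_zero, Algebra.smul_def] at hs
    exact mul_ne_zero hr0 hc0 hs.symm
  · obtain ⟨d, hd⟩ := hrA _ (hpow n)
    refine ⟨d, ?_⟩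
    rw [hd, Algebra.smul_def, Algebra.smul_def, hs, Algebra.smul_def]
    ring

/-- Replace `A A⁻¹` by a finitely generated `J` with the same t-closure. Any `u ∈ J⁻¹` also sends `A
A⁻¹` into `D`, so `u A⁻¹ ⊆ A⁻¹`, and complete integral closure gives `u ∈ D`. Hence `1 ∈ J_v = J_t`.
-/
theorem IsKrullDomain.allTInvertible (h : IsKrullDomain D K) : AllTInvertible D K := by
  intro A hA0 hA1 hAt
  have hA' := inv_ne_zero_of_ne_zero hA0
  have hB0 := fractionalIdeal_mul_ne_zero hA0 hA'
  refine .of_one_le hA0 hAt ?_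
  obtain ⟨J, hJB, hJ0, hJf, hBJ⟩ := h.isMoriDomain.exists_fg hB0 mul_one_div_le_one
  refine le_trans ?_ (tClosure_mono hJB)
  rw [tClosure_eq_vClosure_of_fg hJf]
  refine one_le.2 ?_
  rw [vClosure, mem_inv_iff (inv_ne_zero_of_ne_zero hJ0)]
  intro u hu
  rw [one_mul]
  have hu' : u ∈ (A * A⁻¹)⁻¹ :=
    inv_anti_mono hB0 (tClosure_ne_zero hJ0) hBJ (le_inv_tClosure hJ0 hu)
  refine h.isCompletelyIntegrallyClosed.mem_one hA' fun z hz => ?_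
  rw [mem_inv_iff hA0]
  intro y hy
  rw [mul_assoc, mul_comm z]
  exact (mem_inv_iff hB0).1 hu' _ (mul_mem_mul hy hz)

/-- In a Mori domain every proper integral `t`-ideal is contained in a prime `t`-ideal. -/
theorem IsMoriDomain.exists_isPrime_le (h : IsMoriDomain D K) {A : FractionalIdeal D⁰ K}
    (hA0 : A ≠ 0) (hA1 : A < 1) (hAt : tClosure A = A) :
    ∃ P : Ideal D, P.IsPrime ∧ A ≤ P ∧
      tClosure (P : FractionalIdeal D⁰ K) = (P : FractionalIdeal D⁰ K) := by
  obtain ⟨M, ⟨hAM, hM1, hMt⟩, hmax⟩ := h.exists_maximal {B | A ≤ B ∧ B < 1 ∧ tClosure B = B}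
    ⟨A, le_rfl, hA1, hAt⟩ fun B hB => ⟨fun h0 => hA0 (le_antisymm (h0 ▸ hB.1) (zero_le _)),
      hB.2.1.le, hB.2.2⟩
  obtain ⟨P, rfl⟩ := le_one_iff_exists_coeIdeal.1 hM1.le
  have hmem : ∀ {d : D}, algebraMap D K d ∈ (P : FractionalIdeal D⁰ K) ↔ d ∈ P := by
    intro d
    refine ⟨fun hd => ?_, fun hd => (mem_coeIdeal _).2 ⟨d, hd, rfl⟩⟩
    obtain ⟨e, he, hed⟩ := (mem_coeIdeal _).1 hd
    rwa [← IsFractionRing.injective D K hed]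
  refine ⟨P, ⟨fun hP => hM1.ne (by rw [hP, coeIdeal_top]), fun {x y} hxy => ?_⟩, hAM, hMt⟩
  by_contra! hcon
  obtain ⟨hx, hy⟩ := hcon
  set x' := algebraMap D K x
  set Q := (P : FractionalIdeal D⁰ K) ⊔ spanSingleton D⁰ x'
  have hPQ : (P : FractionalIdeal D⁰ K) ≤ tClosure Q := le_sup_left.trans (le_tClosure Q)
  have hQ1 : tClosure Q ≤ 1 := (tClosure_mono
    (sup_le hM1.le (spanSingleton_le_one_iff.2 ⟨x, rfl⟩))).trans tClosure_one.le
  have hQ : tClosure Q = 1 := by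
    by_contra hne
    have := hmax ⟨hAM.trans hPQ, lt_of_le_of_ne hQ1 hne, tClosure_idem Q⟩ hPQ
    exact hx (hmem.1 (this (le_tClosure Q (le_sup_right (a := (P : FractionalIdeal D⁰ K))
      (mem_spanSingleton_self _ x')))))
  -- Since `Q_t = D` and `y Q = y P + x y D ⊆ P`, also `y ∈ (y Q)_t ⊆ P_t = P`.
  refine hy (hmem.1 (spanSingleton_le_iff_mem.1 ?_))
  rw [← hMt]
  refine (le_tClosure_mul_of_tClosure_eq_one _ hQ).trans (tClosure_mono ?_)
  rw [spanSingleton_mul_le_iff]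
  intro z hz
  rw [← mem_coe, coe_sup, Submodule.mem_sup] at hz
  obtain ⟨p, hp, w, hw, rfl⟩ := hz
  obtain ⟨q, hq, rfl⟩ := (mem_coeIdeal _).1 hp
  obtain ⟨c, rfl⟩ := (mem_spanSingleton _).1 hw
  rw [Algebra.smul_def, ← map_mul, ← map_add, ← map_mul, hmem, mul_add]
  refine P.add_mem (P.mul_mem_left y hq) ?_
  rw [mul_left_comm, mul_comm y]
  exact P.mul_mem_left c hxy

/-- In a Krull domain every integral `t`-ideal is a `t`-product of prime ideals. -/
theorem IsKrullDomain.exists_isPrime_factorization (h : IsKrullDomain D K) (A : TInv D K)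
    (hA : 1 ≤ A) : ∃ s : Multiset (TInv D K),
      (∀ P ∈ s, ∃ I : Ideal D, I.IsPrime ∧ P.1 = (I : FractionalIdeal D⁰ K)) ∧ A = s.prod := by
  by_contra hcon
  obtain ⟨_, ⟨A, hA, hcon, rfl⟩, hmax⟩ := h.isMoriDomain.exists_maximal
    {B | ∃ A : TInv D K, 1 ≤ A ∧ (¬ ∃ s : Multiset (TInv D K),
      (∀ P ∈ s, ∃ I : Ideal D, I.IsPrime ∧ P.1 = (I : FractionalIdeal D⁰ K)) ∧ A = s.prod) ∧
      A.1 = B} ⟨_, A, hA, hcon, rfl⟩ (by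
      rintro _ ⟨A, hA, -, rfl⟩
      exact ⟨A.2.ne_zero, hA, A.2.tClosure_eq⟩)
  have hA1 : A.1 < 1 := lt_of_le_of_ne hA fun e => hcon ⟨0, by simp, Subtype.ext e⟩
  obtain ⟨I, hI, hAI, hIt⟩ := h.isMoriDomain.exists_isPrime_le A.2.ne_zero hA1 A.2.tClosure_eq
  obtain ⟨P, hP⟩ : ∃ P : TInv D K, P.1 = (I : FractionalIdeal D⁰ K) :=
    ⟨⟨_, h.allTInvertible _ (fun h0 => A.2.ne_zero (le_antisymm (h0 ▸ hAI) (zero_le _)))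
      coeIdeal_le_one hIt⟩, rfl⟩
  have hPA : P ≤ A := by rw [TInv.le_iff, hP]; exact hAI
  have hP1 : 1 ≤ P := by rw [TInv.one_le_iff, hP]; exact coeIdeal_le_one
  by_cases hAP : ∃ s : Multiset (TInv D K),
      (∀ P ∈ s, ∃ I : Ideal D, I.IsPrime ∧ P.1 = (I : FractionalIdeal D⁰ K)) ∧ A / P = s.prod
  · obtain ⟨s, hs, hAs⟩ := hAP
    refine hcon ⟨P ::ₘ s, fun Q hQ => ?_, by
      rw [Multiset.prod_cons, ← hAs, mul_div_cancel]⟩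
    rcases Multiset.mem_cons.1 hQ with rfl | hQ
    · exact ⟨I, hI, hP⟩
    · exact hs Q hQ
  · have h1 : A ≤ A / P := hmax ⟨A / P, one_le_div'.2 hPA, hAP, rfl⟩
      ((div_le_self_iff A).2 hP1)
    have h2 : P = 1 := le_antisymm (by simpa using h1) hP1
    rw [h2, TInv.coe_one] at hP
    exact hI.ne_top ((coeIdeal_injective (K := K)) (hP.symm.trans (coeIdeal_top _).symm))

theorem IsKrullDomain.isTVIFD (h : IsKrullDomain D K) : IsTVIFD D K := by
  intro a ha
  have ha' : algebraMap D K a ≠ 0 := by simpa using ha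
  obtain ⟨t, ht, hat⟩ := h.exists_isPrime_factorization (principal _ ha')
    (spanSingleton_le_one_iff.2 ⟨a, rfl⟩)
  have key : ∃ s : Multiset (Ideal D), (∀ I ∈ s, IsValuationIdeal K I) ∧
      t.prod.1 = tClosure ((s.prod : Ideal D) : FractionalIdeal D⁰ K) := by
    clear hat
    induction t using Multiset.induction with
    | empty =>
      exact ⟨0, by simp, by
        rw [Multiset.prod_zero, Multiset.prod_zero, TInv.coe_one, Ideal.one_eq_top, coeIdeal_top,
          tClosure_one]⟩
    | cons P t ih =>
      obtain ⟨s, hs, hts⟩ := ih fun Q hQ => ht Q (Multiset.mem_cons_of_mem hQ)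
      obtain ⟨I, hI, hP⟩ := ht P (Multiset.mem_cons_self P t)
      refine ⟨I ::ₘ s, fun J hJ => ?_, by
        rw [Multiset.prod_cons, Multiset.prod_cons, TInv.coe_mul, hts, hP, tClosure_mul_tClosure,
          coeIdeal_mul]⟩
      rcases Multiset.mem_cons.1 hJ with rfl | hJ
      · exact isValuationIdeal_of_isPrime K J
      · exact hs J hJ
  obtain ⟨s, hs, hts⟩ := key
  -- The harmless factor `D` ensures `n ≥ 1` when `a` is a unit and `s` is empty.
  refine ⟨⊤ ::ₘ s, Multiset.cons_ne_zero, fun J hJ => ?_, ?_⟩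
  · rcases Multiset.mem_cons.1 hJ with rfl | hJ
    · exact isValuationIdeal_top K
    · exact hs J hJ
  · rw [Multiset.prod_cons, Ideal.top_mul, ← hts, ← hat, coeIdeal_span_singleton]
    rfl

/-- Principal ideals are t-ideals, so a non-factorable element generating a maximal ideal among such
exists; its proper factors generate strictly larger ideals and do factor. -/
theorem IsMoriDomain.isAtomicDomain (h : IsMoriDomain D K) : IsAtomicDomain D := by
  by_contra hcon
  unfold IsAtomicDomain at hcon
  push Not at hcon
  obtain ⟨a, ha, hau, has⟩ := hcon
  obtain ⟨_, ⟨a, ha, hau, has, rfl⟩, hmax⟩ := h.exists_maximal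
    {A | ∃ a : D, a ≠ 0 ∧ ¬ IsUnit a ∧
      (∀ s : Multiset D, (∀ u ∈ s, Irreducible u) → a ≠ s.prod) ∧
      spanSingleton D⁰ (algebraMap D K a) = A} ⟨_, a, ha, hau, has, rfl⟩ (by
      rintro _ ⟨a, ha, -, -, rfl⟩
      exact ⟨spanSingleton_ne_zero_iff.2 (by simpa using ha),
        spanSingleton_le_one_iff.2 ⟨a, rfl⟩, tClosure_spanSingleton _⟩)
  have hfac : ∀ b c : D, a = b * c → ¬ IsUnit b → ¬ IsUnit c →
      ∃ s : Multiset D, (∀ u ∈ s, Irreducible u) ∧ b = s.prod := by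
    intro b c habc hb hc
    by_contra! hbs
    have hb0 : b ≠ 0 := fun h0 => ha (by rw [habc, h0, zero_mul])
    have hab := spanSingleton_algebraMap_le_iff.1 (hmax ⟨b, hb0, hb, hbs, rfl⟩
      (spanSingleton_algebraMap_le_iff.2 ⟨c, habc⟩))
    rw [habc] at hab
    exact hc (isUnit_of_dvd_one ((mul_dvd_mul_iff_left hb0).1 (by rwa [mul_one])))
  have hirr : ¬ Irreducible a := fun h => has {a} (by simpa using h) (by simp)
  rw [irreducible_iff] at hirr
  push Not at hirr
  obtain ⟨b, c, habc, hb, hc⟩ := hirr hau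
  obtain ⟨s, hs, hbs⟩ := hfac b c habc hb hc
  obtain ⟨t, ht, hct⟩ := hfac c b (by rw [habc, mul_comm]) hc hb
  exact has (s + t) (fun u hu => (Multiset.mem_add.1 hu).elim (hs u) (ht u))
    (by rw [Multiset.prod_add, ← hbs, ← hct, habc])

omit [IsFractionRing D K] in
theorem IsValuationElement.unit_mul {v : D} (hv : IsValuationElement K v) (u : Dˣ) :
    IsValuationElement K (u * v) := by
  obtain ⟨h0, hu, hval⟩ := hv
  refine ⟨mul_ne_zero u.ne_zero h0, fun h => hu (isUnit_of_mul_isUnit_right h), ?_⟩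
  rwa [Ideal.span_singleton_mul_left_unit u.isUnit]

theorem IsKrullDomain.isAVFD (hexp : Monoid.ExponentExists (TClassGroup D K))
    (h : IsKrullDomain D K) : IsAVFD D K := by
  intro a ha hau
  obtain ⟨k, hk, hkH⟩ := exists_pow_mem_prin hexp
  have ha' : algebraMap D K a ≠ 0 := by simpa using ha
  obtain ⟨t, ht, hat⟩ := h.exists_isPrime_factorization (principal _ ha')
    (spanSingleton_le_one_iff.2 ⟨a, rfl⟩)
  have key : ∃ s : Multiset D, (∀ v ∈ s, IsValuationElement K v) ∧
      (t.prod ^ k).1 = spanSingleton D⁰ (algebraMap D K s.prod) := by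
    clear hat
    induction t using Multiset.induction with
    | empty =>
      exact ⟨0, by simp, by
        rw [Multiset.prod_zero, Multiset.prod_zero, map_one, spanSingleton_one, one_pow,
          TInv.coe_one]⟩
    | cons P t ih =>
      obtain ⟨s, hs, hts⟩ := ih fun Q hQ => ht Q (Multiset.mem_cons_of_mem hQ)
      obtain ⟨I, hI, hP⟩ := ht P (Multiset.mem_cons_self P t)
      have hP1 : 1 ≤ P := by rw [TInv.one_le_iff, hP]; exact coeIdeal_le_one
      obtain ⟨x, hx, hPx⟩ := exists_eq_spanSingleton_of_mem_prin (hkH P)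
        (one_le_pow_of_one_le' hP1 k)
      refine ⟨x ::ₘ s, fun v hv => ?_, by
        rw [Multiset.prod_cons, Multiset.prod_cons, mul_pow]
        exact TInv.coe_mul_eq_spanSingleton hPx hts⟩
      rcases Multiset.mem_cons.1 hv with rfl | hv
      · refine ⟨hx, fun hu => ?_, ?_⟩
        · have h1 : P ^ k = 1 := by
            refine le_antisymm ?_ (one_le_pow_of_one_le' hP1 k)
            rw [TInv.le_iff, hPx]
            exact one_le_spanSingleton_algebraMap_iff.2 hu
          rw [eq_one_of_pow_eq_one hk hP1 h1, TInv.coe_one] at hP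
          exact hI.ne_top ((coeIdeal_injective (K := K)) (hP.symm.trans (coeIdeal_top _).symm))
        · obtain ⟨V, hV, hVI⟩ := isValuationIdeal_of_isPrime K I
          -- The prime `P` is valued by the cone of `V`, hence so is `P ^ k = x D`.
          refine isValuationIdeal_span_singleton V hV hx hPx
            (.pow (isValuationCone_valuationCone V hV)
              (isValuedBy_valuationCone V hV hVI ?_) k)
          rw [← hP, P.2.tClosure_eq]
      · exact hs v hv
  obtain ⟨s, hs, hts⟩ := key
  have hak : (principal (D := D) _ ha' ^ k).1 = spanSingleton D⁰ (algebraMap D K (a ^ k)) := by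
    clear hk hkH hts
    induction k with
    | zero => rw [pow_zero, pow_zero, map_one, spanSingleton_one, TInv.coe_one]
    | succ n ih =>
      rw [pow_succ, pow_succ]
      exact TInv.coe_mul_eq_spanSingleton ih rfl
  rw [← hat, hak] at hts
  obtain ⟨u, hu⟩ : Associated s.prod (a ^ k) := associated_of_dvd_dvd
    (spanSingleton_algebraMap_le_iff.1 hts.le) (spanSingleton_algebraMap_le_iff.1 hts.ge)
  refine ⟨k, hk, ?_⟩
  -- The unit `u` has to be absorbed into one factor; there is one, since otherwise `a ^ k` would be
  -- a unit.
  rcases s.empty_or_exists_mem with rfl | ⟨v, hv⟩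
  · rw [Multiset.prod_zero, one_mul] at hu
    exact absurd ((isUnit_pow_iff hk.ne').1 (hu ▸ u.isUnit)) hau
  · obtain ⟨s, rfl⟩ := Multiset.exists_cons_of_mem hv
    refine ⟨(u * v) ::ₘ s, fun w hw => ?_, by
      rw [← hu, Multiset.prod_cons, Multiset.prod_cons]; ring⟩
    rcases Multiset.mem_cons.1 hw with rfl | hw
    · exact (hs v hv).unit_mul u
    · exact hs w (Multiset.mem_cons_of_mem hw)

end Krull

end

end TOp

theorem theorem5p10 {D : Type*} [CommRing D] [IsDomain D] (K : Type*) [Field K] [Algebra D K]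
    [IsFractionRing D K] (hexp : Monoid.ExponentExists (TOp.TClassGroup D K)) :
    (TOp.IsKrullDomain D K ↔ TOp.IsAtomicDomain D ∧ TOp.IsTVIFD D K) ∧
      (TOp.IsKrullDomain D K → TOp.IsAVFD D K) :=
  ⟨⟨fun h => ⟨h.isMoriDomain.isAtomicDomain, h.isTVIFD⟩, fun h =>
    TOp.isKrullDomain_of_isAtomicDomain_of_isTVIFD hexp h.1 h.2⟩, fun h => h.isAVFD hexp⟩
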